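/- **Proposition 4.4.** Let $M=G/K$ be an irreducible symmetric space of non-compact type, where the connected Lie group $G$ acts transitively and by isometries on $M$ and $K$ is the isotropy group of a point $o\in M$. Let $\theta$ be the corresponding Cartan involution of the Lie algebra $\mathfrak g$ of $G$, $\mathfrak g=\mathfrak k\oplus\mathfrak p$ its Cartan decomposition, $\mathfrak a$ a maximal abelian subspace of $\mathfrak p$, and $\mathfrak n=\bigoplus_{\lambda\in\Sigma^+}\mathfrak g_\lambda$ the sum of the restricted root spaces of the roots that are positive for some positivity criterion on $\mathfrak a^*$. Let $AN$ be the connected Lie subgroup of $G$ with Lie algebra $\mathfrak a\oplus\mathfrak n$, endowed with the left-invariant metric $\langle\cdot,\cdot\rangle$ obtained by pulling back the metric of $M$ along $AN\to M$, $h\mapsto h\cdot o$. Let $H\in\mathfrak a$ be a unit vector with respect to $\langle\cdot,\cdot\rangle$, and let $S$ be the connected Lie subgroup of $AN$ with Lie algebra $$\mathfrak s=(\mathfrak a\ominus\mathbb R H)\oplus\mathfrak n,$$ where $\ominus$ denotes orthogonal complement, endowed with the metric induced from $AN$. Then $S$ is a solvsoliton, that is, $S$ is solvable and its Ricci operator (the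 $(1,1)$-Ricci tensor, regarded as an endomorphism of $\mathfrak s$) has the form $\mathrm{Ric}=c\,\mathrm{Id}+D$ for some $c\in\mathbb R$ and some derivation $D$ of $\mathfrak s$. More precisely, there is a real number $k<0$ such that $\mathrm{Ric}^{AN}=k\,\mathrm{Id}$ (the Einstein constant of $M\cong AN$), the restriction of $\mathrm{ad}(H)$ to $\mathfrak s$ is a derivation of $\mathfrak s$, and $$\mathrm{Ric}=k\,\mathrm{Id}+\operatorname{tr}(\mathrm{ad}(H))\,\mathrm{ad}(H)\quad\text{on }\mathfrak s,$$ where the trace is that of the restriction of $\mathrm{ad}(H)$ to $\mathfrak s$. -/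

import Mathlib

open scoped Manifold ContDiff
open Bundle

noncomputable section

/-! Manifolds are smooth, finite-dimensional and without boundary: they are modelled on a
finite-dimensional real normed space `E` through `𝓘(ℝ, E)`. -/

instance completeSpaceOfFiniteDimensionalReal {E : Type*} [NormedAddCommGroup E]
    [NormedSpace ℝ E] [FiniteDimensional ℝ E] : CompleteSpace E :=
  FiniteDimensional.complete ℝ E

/-- Smooth Lie groups have the regularity under which Mathlib constructs their Lie algebra. -/
instance lieGroupMinSmoothness {E : Type*} [NormedAddCommGroup E] [NormedSpace ℝ E]
    {G : Type*} [TopologicalSpace G] [ChartedSpace E G] [Group G] [h : LieGroup 𝓘(ℝ, E) ∞ G] :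
    LieGroup 𝓘(ℝ, E) (minSmoothness ℝ 3) G := by
  rw [minSmoothness_of_isRCLikeNormedField]
  infer_instance

/-! ### Levi-Civita connection and curvature -/

section Riemannian

variable {E : Type*} [NormedAddCommGroup E] [NormedSpace ℝ E] [FiniteDimensional ℝ E]
  {M : Type*} [TopologicalSpace M] [ChartedSpace E M] [IsManifold 𝓘(ℝ, E) ∞ M]

/-- `nabla` is the Levi-Civita connection of the Riemannian manifold `M`: it is torsion free, and
`v⟨Y, Z⟩ = ⟨∇_v Y, Z⟩ + ⟨Y, ∇_v Z⟩`. (Mathlib writes `nabla Y x v` for `∇_v Y`, `v ∈ T_x M`.) -/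
structure IsLeviCivita [RiemannianBundle (fun x : M ↦ TangentSpace 𝓘(ℝ, E) x)]
    (nabla : CovariantDerivative 𝓘(ℝ, E) E (TangentSpace 𝓘(ℝ, E) : M → Type _)) : Prop where
  torsion_eq_zero : nabla.torsion = 0
  metric (Y Z : Π x : M, TangentSpace 𝓘(ℝ, E) x) (x : M) (v : TangentSpace 𝓘(ℝ, E) x) :
    MDiffAt (fun y ↦ (Y y : TangentBundle 𝓘(ℝ, E) M)) x →
    MDiffAt (fun y ↦ (Z y : TangentBundle 𝓘(ℝ, E) M)) x →
    mfderiv 𝓘(ℝ, E) 𝓘(ℝ, ℝ) (fun y ↦ inner ℝ (Y y) (Z y)) x v =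
      inner ℝ (nabla Y x v) (Z x) + inner ℝ (Y x) (nabla Z x v)

/-- The curvature `R(X, Y) Z = ∇_X ∇_Y Z - ∇_Y ∇_X Z - ∇_[X, Y] Z` on vector fields. -/
def curvature (nabla : CovariantDerivative 𝓘(ℝ, E) E (TangentSpace 𝓘(ℝ, E) : M → Type _))
    (X Y Z : Π x : M, TangentSpace 𝓘(ℝ, E) x) (x : M) : TangentSpace 𝓘(ℝ, E) x :=
  nabla (fun y ↦ nabla Z y (Y y)) x (X x) - nabla (fun y ↦ nabla Z y (X y)) x (Y x)
    - nabla Z x (VectorField.mlieBracket 𝓘(ℝ, E) X Y x)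

end Riemannian

/-- The derivative of `f` preserves the Riemannian metrics. -/
def IsIsometricImmersion
    {E : Type*} [NormedAddCommGroup E] [NormedSpace ℝ E]
    {M : Type*} [TopologicalSpace M] [ChartedSpace E M]
    [RiemannianBundle (fun x : M ↦ TangentSpace 𝓘(ℝ, E) x)]
    {E' : Type*} [NormedAddCommGroup E'] [NormedSpace ℝ E']
    {M' : Type*} [TopologicalSpace M'] [ChartedSpace E' M']
    [RiemannianBundle (fun x : M' ↦ TangentSpace 𝓘(ℝ, E') x)]
    (f : M → M') : Prop :=
  ContMDiff 𝓘(ℝ, E) 𝓘(ℝ, E') ∞ f ∧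
    ∀ (x : M) (v w : TangentSpace 𝓘(ℝ, E) x),
      inner ℝ (mfderiv 𝓘(ℝ, E) 𝓘(ℝ, E') f x v) (mfderiv 𝓘(ℝ, E) 𝓘(ℝ, E') f x w) = inner ℝ v w

/-! ### Lie groups with a left-invariant metric -/

section LieGroups

variable {E : Type*} [NormedAddCommGroup E] [NormedSpace ℝ E] [FiniteDimensional ℝ E]
  {S : Type*} [TopologicalSpace S] [ChartedSpace E S] [Group S] [LieGroup 𝓘(ℝ, E) ∞ S]

instance finiteDimensionalTangentSpace (x : S) : FiniteDimensional ℝ (TangentSpace 𝓘(ℝ, E) x) :=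
  inferInstanceAs (FiniteDimensional ℝ E)

/-- The `(1,1)`-Ricci tensor at the identity, `Ric v = ∑ᵢ R(v, eᵢ) eᵢ` for an orthonormal basis
`eᵢ` of the Lie algebra. As curvature is tensorial, it may be computed from the left-invariant
extensions of these tangent vectors. -/
def ricciOperator [RiemannianBundle (fun x : S ↦ TangentSpace 𝓘(ℝ, E) x)]
    (nabla : CovariantDerivative 𝓘(ℝ, E) E (TangentSpace 𝓘(ℝ, E) : S → Type _))
    (v : GroupLieAlgebra 𝓘(ℝ, E) S) : GroupLieAlgebra 𝓘(ℝ, E) S :=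
  ∑ i, curvature nabla (mulInvariantVectorField v)
    (mulInvariantVectorField (stdOrthonormalBasis ℝ (TangentSpace 𝓘(ℝ, E) (1 : S)) i))
    (mulInvariantVectorField (stdOrthonormalBasis ℝ (TangentSpace 𝓘(ℝ, E) (1 : S)) i)) 1

/-- `S` is solvable and its left-invariant metric is an algebraic Ricci soliton: `Ric = c Id + D`
for a real number `c` and a derivation `D` of the Lie algebra of `S`. A connected Lie group is
solvable if its Lie algebra is. -/
def IsSolvsoliton [RiemannianBundle (fun x : S ↦ TangentSpace 𝓘(ℝ, E) x)]
    (nabla : CovariantDerivative 𝓘(ℝ, E) E (TangentSpace 𝓘(ℝ, E) : S → Type _)) : Prop :=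
  LieAlgebra.IsSolvable (GroupLieAlgebra 𝓘(ℝ, E) S) ∧
    ∃ (c : ℝ) (D : LieDerivation ℝ (GroupLieAlgebra 𝓘(ℝ, E) S) (GroupLieAlgebra 𝓘(ℝ, E) S)),
      ∀ v : GroupLieAlgebra 𝓘(ℝ, E) S, ricciOperator nabla v = c • v + D v

variable {E' : Type*} [NormedAddCommGroup E'] [NormedSpace ℝ E']
  {G : Type*} [TopologicalSpace G] [ChartedSpace E' G] [Group G]

/-- The differential at the identity `Lie S → Lie G` of a homomorphism `S → G`
(recall that `ι 1 = 1`). -/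
def lieMap (ι : S →* G) : GroupLieAlgebra 𝓘(ℝ, E) S →ₗ[ℝ] GroupLieAlgebra 𝓘(ℝ, E') G :=
  (mfderiv 𝓘(ℝ, E) 𝓘(ℝ, E') ι 1 : TangentSpace 𝓘(ℝ, E) (1 : S) →ₗ[ℝ] TangentSpace 𝓘(ℝ, E') (ι 1))

/-- Through `ι`, the Lie group `S` is the connected (immersed) Lie subgroup of `G` with Lie
algebra `𝔥`. -/
structure IsConnectedLieSubgroup (ι : S →* G)
    (𝔥 : Submodule ℝ (GroupLieAlgebra 𝓘(ℝ, E') G)) : Prop where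
  connected : ConnectedSpace S
  contMDiff : ContMDiff 𝓘(ℝ, E) 𝓘(ℝ, E') ∞ ι
  injective : Function.Injective ι
  injective_lieMap : Function.Injective (lieMap (E := E) (E' := E') ι)
  range_lieMap : LinearMap.range (lieMap (E := E) (E' := E') ι) = 𝔥

end LieGroups

/-! ### Symmetric spaces of non-compact type -/

section SymmetricSpace

variable {E : Type*} [NormedAddCommGroup E] [NormedSpace ℝ E] [FiniteDimensional ℝ E]
  {G : Type*} [TopologicalSpace G] [ChartedSpace E G] [Group G] [LieGroup 𝓘(ℝ, E) ∞ G]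
  {F : Type*} [NormedAddCommGroup F] [NormedSpace ℝ F]
  {M : Type*} [TopologicalSpace M] [ChartedSpace F M] [MulAction G M]

/-- The differential at the identity of the orbit map `G → M`, `g ↦ g • o`. -/
def orbitMapDeriv (o : M) :
    TangentSpace 𝓘(ℝ, E) (1 : G) →ₗ[ℝ] TangentSpace 𝓘(ℝ, F) ((1 : G) • o) :=
  (mfderiv 𝓘(ℝ, E) 𝓘(ℝ, F) (fun g : G ↦ g • o) 1 :
    TangentSpace 𝓘(ℝ, E) (1 : G) →L[ℝ] TangentSpace 𝓘(ℝ, F) ((1 : G) • o))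

/-- The `-1`-eigenspace `𝔭` of the involution `θ`. -/
def pSpace (θ : GroupLieAlgebra 𝓘(ℝ, E) G →ₗ⁅ℝ⁆ GroupLieAlgebra 𝓘(ℝ, E) G) :
    Submodule ℝ (GroupLieAlgebra 𝓘(ℝ, E) G) where
  carrier := {X | θ X = -X}
  add_mem' {X Y} hX hY := by
    have hX' : θ X = -X := hX
    have hY' : θ Y = -Y := hY
    change θ (X + Y) = -(X + Y)
    rw [map_add, hX', hY', neg_add]
  zero_mem' := by
    change θ 0 = -0
    simp
  smul_mem' c X hX := by
    have hX' : θ X = -X := hX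
    change θ (c • X) = -(c • X)
    rw [map_smul, hX', smul_neg]

/-- The Riemannian manifold `M = G / K` is an irreducible symmetric space of non-compact type, where
`K` is the isotropy group of `o`: the connected Lie group `G` acts transitively and by isometries on
`M`, and `θ` is a Cartan involution of the Lie algebra `𝔤` of `G` (which is thereby semisimple)
whose `+1`-eigenspace is the Lie algebra `𝔨` of `K`, i.e. the kernel of the differential of the
orbit map of `o`. Irreducibility: the isotropy representation of `𝔨` on `𝔭 ≅ T_o M` is
irreducible. -/
structure IsIrreducibleSymmetricSpace [RiemannianBundle (fun x : M ↦ TangentSpace 𝓘(ℝ, F) x)]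
    (o : M) (θ : GroupLieAlgebra 𝓘(ℝ, E) G →ₗ⁅ℝ⁆ GroupLieAlgebra 𝓘(ℝ, E) G) : Prop where
  connected : ConnectedSpace G
  smooth : ContMDiffSMul 𝓘(ℝ, E) 𝓘(ℝ, F) ∞ G M
  transitive : MulAction.IsPretransitive G M
  isometric (g : G) : IsIsometricImmersion (E := F) (E' := F) (fun x : M ↦ g • x)
  involutive (X : GroupLieAlgebra 𝓘(ℝ, E) G) : θ (θ X) = X
  cartan (X : GroupLieAlgebra 𝓘(ℝ, E) G) : X ≠ 0 →
    0 < -killingForm ℝ (GroupLieAlgebra 𝓘(ℝ, E) G) (θ X) X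
  isotropy (X : GroupLieAlgebra 𝓘(ℝ, E) G) : θ X = X ↔ orbitMapDeriv (F := F) o X = 0
  nontrivial : pSpace θ ≠ ⊥
  irreducible (W : Submodule ℝ (GroupLieAlgebra 𝓘(ℝ, E) G)) : W ≤ pSpace θ →
    (∀ X Y : GroupLieAlgebra 𝓘(ℝ, E) G, θ X = X → Y ∈ W → ⁅X, Y⁆ ∈ W) → W = ⊥ ∨ W = pSpace θ

/-- `𝔞` is a maximal abelian subspace of `𝔭`. -/
structure IsMaximalAbelian (θ : GroupLieAlgebra 𝓘(ℝ, E) G →ₗ⁅ℝ⁆ GroupLieAlgebra 𝓘(ℝ, E) G)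
    (𝔞 : Submodule ℝ (GroupLieAlgebra 𝓘(ℝ, E) G)) : Prop where
  le : 𝔞 ≤ pSpace θ
  abelian : ∀ X ∈ 𝔞, ∀ Y ∈ 𝔞, ⁅X, Y⁆ = 0
  maximal : ∀ 𝔟 : Submodule ℝ (GroupLieAlgebra 𝓘(ℝ, E) G), 𝔟 ≤ pSpace θ →
    (∀ X ∈ 𝔟, ∀ Y ∈ 𝔟, ⁅X, Y⁆ = 0) → 𝔞 ≤ 𝔟 → 𝔟 = 𝔞

/-- The restricted root space `𝔤_l = {X | [A, X] = l(A) X for all A ∈ 𝔞}`. -/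
def rootSpace (𝔞 : Submodule ℝ (GroupLieAlgebra 𝓘(ℝ, E) G)) (l : Module.Dual ℝ 𝔞) :
    Submodule ℝ (GroupLieAlgebra 𝓘(ℝ, E) G) where
  carrier := {X | ∀ A : 𝔞, ⁅(A : GroupLieAlgebra 𝓘(ℝ, E) G), X⁆ = l A • X}
  add_mem' hX hY A := by rw [lie_add, hX A, hY A, smul_add]
  zero_mem' A := by simp
  smul_mem' c X hX A := by rw [lie_smul, hX A, smul_comm]

/-- The set of restricted roots. -/
def restrictedRoots (𝔞 : Submodule ℝ (GroupLieAlgebra 𝓘(ℝ, E) G)) : Set (Module.Dual ℝ 𝔞) :=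
  {l | l ≠ 0 ∧ rootSpace 𝔞 l ≠ ⊥}

/-- A positivity criterion on a real vector space: exactly one of `v`, `-v` is positive for every
`v ≠ 0`, and sums and positive multiples of positive vectors are positive. -/
structure IsPositivity {V : Type*} [AddCommGroup V] [Module ℝ V] (P : Set V) : Prop where
  xor : ∀ v : V, v ≠ 0 → Xor (v ∈ P) (-v ∈ P)
  add : ∀ v ∈ P, ∀ w ∈ P, v + w ∈ P
  smul : ∀ v ∈ P, ∀ t : ℝ, 0 < t → t • v ∈ P

/-- The nilpotent part `𝔫` of the Iwasawa decomposition: the sum of the root spaces of the positive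
restricted roots. -/
def nilpotentPart (𝔞 : Submodule ℝ (GroupLieAlgebra 𝓘(ℝ, E) G)) (P : Set (Module.Dual ℝ 𝔞)) :
    Submodule ℝ (GroupLieAlgebra 𝓘(ℝ, E) G) :=
  ⨆ l ∈ restrictedRoots 𝔞 ∩ P, rootSpace 𝔞 l

/-- The inner product on `𝔞` obtained by pulling back the metric of `M` along the orbit map. -/
def orbitInner [RiemannianBundle (fun x : M ↦ TangentSpace 𝓘(ℝ, F) x)] (o : M)
    (X Y : GroupLieAlgebra 𝓘(ℝ, E) G) : ℝ :=
  inner ℝ (orbitMapDeriv (F := F) o X) (orbitMapDeriv (F := F) o Y)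

/-- `𝔞 ⊖ ℝ A`. -/
def orthogonalIn [RiemannianBundle (fun x : M ↦ TangentSpace 𝓘(ℝ, F) x)] (o : M)
    (𝔞 : Submodule ℝ (GroupLieAlgebra 𝓘(ℝ, E) G)) (A : GroupLieAlgebra 𝓘(ℝ, E) G) :
    Submodule ℝ (GroupLieAlgebra 𝓘(ℝ, E) G) where
  carrier := {X | X ∈ 𝔞 ∧ orbitInner (F := F) o X A = 0}
  add_mem' := by
    rintro X Y ⟨hX, hX'⟩ ⟨hY, hY'⟩
    refine ⟨𝔞.add_mem hX hY, ?_⟩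
    unfold orbitInner at *
    rw [map_add, inner_add_left, hX', hY', add_zero]
  zero_mem' := by
    refine ⟨𝔞.zero_mem, ?_⟩
    unfold orbitInner
    rw [map_zero, inner_zero_left]
  smul_mem' := by
    rintro c X ⟨hX, hX'⟩
    refine ⟨𝔞.smul_mem c hX, ?_⟩
    unfold orbitInner at *
    rw [map_smul, real_inner_smul_left, hX', mul_zero]

end SymmetricSpace

end


noncomputable section

/-!
Schur's lemma for the isotropy representation shows that the metric of `M` on `𝔭` is a multiple `c`
of the Killing form. Projecting `𝔞 ⊕ 𝔫` to `𝔭` turns the Levi-Civita connection of `AN` into the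
bracket with the `𝔨`-component and its curvature into `-[[X, Y], Z]`, so taking traces gives
`Ric^{AN} = -(2c)⁻¹ Id`. Elements of `𝔞` have no `𝔨`-component, so the unit normal `H` of `𝔰` in
`𝔞 ⊕ 𝔫` satisfies `∇_H = 0`: the shape operator of `S` is, up to sign, `ad H`, and the normal
curvature operator is `-(ad H)²`. In the Gauss equation the `(ad H)²` terms cancel, leaving
`Ric = k Id + tr(ad H) ad H`.
-/
section InnerProducts

variable {V : Type*} [AddCommGroup V] [Module ℝ V]

/-- `B` is an inner product on the real vector space `V`. Lie algebras carry several inner products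
and tangent spaces come with a norm of their own, so these are forms and not instances. -/
structure IsInnerProduct (B : LinearMap.BilinForm ℝ V) : Prop where
  symm (x y : V) : B x y = B y x
  pos (x : V) : x ≠ 0 → 0 < B x x

/-- The vectors `e i` resolve the identity for the form `B`. A basis that is orthonormal for an
inner product is a Parseval frame. -/
def IsParsevalFrame (B : LinearMap.BilinForm ℝ V) {ι : Type*} [Fintype ι] (e : ι → V) : Prop :=
  ∀ x, ∑ i, B x (e i) • e i = x

lemma trace_comp_eq_sum [FiniteDimensional ℝ V] {ι : Type*} [Fintype ι] {S : V →ₗ[ℝ] V}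
    {φ : ι → Module.Dual ℝ V} {e : ι → V} (hS : ∀ x, S x = ∑ i, φ i x • e i) (T : V →ₗ[ℝ] V) :
    LinearMap.trace ℝ V (T ∘ₗ S) = ∑ i, φ i (T (e i)) := by
  have h : T ∘ₗ S = ∑ i, (φ i).smulRight (T (e i)) := by
    ext x
    simp [hS]
  simp only [h, map_sum, LinearMap.trace_smulRight]

lemma IsParsevalFrame.trace_eq [FiniteDimensional ℝ V] {B : LinearMap.BilinForm ℝ V} {ι : Type*}
    [Fintype ι] {e : ι → V} (he : IsParsevalFrame B e) (T : V →ₗ[ℝ] V) :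
    LinearMap.trace ℝ V T = ∑ i, B (T (e i)) (e i) :=
  trace_comp_eq_sum (S := LinearMap.id) (φ := fun i ↦ B.flip (e i)) (fun x ↦ (he x).symm) T

namespace IsInnerProduct

variable {B : LinearMap.BilinForm ℝ V}

lemma ext (hB : IsInnerProduct B) {x y : V} (h : ∀ z, B x z = B y z) : x = y := by
  by_contra hne
  refine (hB.pos _ (sub_ne_zero.2 hne)).ne' ?_
  rw [LinearMap.map_sub₂, h, sub_self]

/-- The inner product `B` in the form from which Mathlib builds an inner product space. -/
abbrev toCore (hB : IsInnerProduct B) : InnerProductSpace.Core ℝ V where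
  inner x y := B x y
  conj_inner_symm x y := hB.symm y x
  re_inner_nonneg x := by
    rcases eq_or_ne x 0 with rfl | h
    · simp
    · exact (hB.pos x h).le
  add_left x y z := by simp
  smul_left x y r := by simp
  definite x h := by
    by_contra hx
    exact (hB.pos x hx).ne' h

lemma nondegenerate [FiniteDimensional ℝ V] (hB : IsInnerProduct B) : B.Nondegenerate := by
  rw [LinearMap.BilinForm.nondegenerate_iff_ker_eq_bot, LinearMap.ker_eq_bot']
  exact fun x hx ↦ hB.ext (by simp [hx])

lemma exists_relative_eigenvector [FiniteDimensional ℝ V] [Nontrivial V] (hB : IsInnerProduct B)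
    {Q : LinearMap.BilinForm ℝ V} (hQ : ∀ x y, Q x y = Q y x) :
    ∃ (c : ℝ) (v : V), v ≠ 0 ∧ ∀ w, Q v w = c * B v w := by
  let _ : NormedAddCommGroup V := hB.toCore.toNormedAddCommGroup
  let _ : InnerProductSpace ℝ V := .ofCore hB.toCore.toCore
  let T : V →ₗ[ℝ] V := (B.toDual hB.nondegenerate).symm.toLinearMap ∘ₗ Q
  have hT x y : B (T x) y = Q x y := by
    rw [← LinearMap.BilinForm.toDual_def hB.nondegenerate]
    simp [T]
  have hT_symm : T.IsSymmetric := fun x y ↦ by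
    change B (T x) y = B x (T y)
    rw [hT, hB.symm x, hT, hQ]
  obtain ⟨c, hc⟩ : ∃ c : ℝ, Module.End.HasEigenvalue T c :=
    ⟨_, hT_symm.hasEigenvalue_iSup_of_finiteDimensional⟩
  obtain ⟨v, hv⟩ := hc.exists_hasEigenvector
  refine ⟨c, v, hv.2, fun w ↦ ?_⟩
  rw [← hT, hv.apply_eq_smul, map_smul]
  rfl

lemma iSup_iInf_eigenspace_eq_top [FiniteDimensional ℝ V] (hB : IsInnerProduct B) {ι : Type*}
    {T : ι → Module.End ℝ V} (hT : ∀ i x y, B (T i x) y = B x (T i y))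
    (hcomm : ∀ i j, Commute (T i) (T j)) :
    ⨆ χ : ι → ℝ, ⨅ i, Module.End.eigenspace (T i) (χ i) = ⊤ := by
  let _ : NormedAddCommGroup V := hB.toCore.toNormedAddCommGroup
  let _ : InnerProductSpace ℝ V := .ofCore hB.toCore.toCore
  exact LinearMap.IsSymmetric.iSup_iInf_eq_top_of_commute (fun i x y ↦ hT i x y)
    fun i j _ ↦ hcomm i j

end IsInnerProduct

end InnerProducts

section MetricLieAlgebras

variable {L : Type*} [LieRing L] [LieAlgebra ℝ L] {q : LinearMap.BilinForm ℝ L} {U : L → L → L}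

/-- `U x y = ∇_x y` is the Levi-Civita connection, on left-invariant vector fields, of the
left-invariant metric defined by `q`. -/
structure IsAlgebraicLeviCivita (q : LinearMap.BilinForm ℝ L) (U : L → L → L) : Prop where
  torsion (x y : L) : U x y - U y x = ⁅x, y⁆
  metric (x y z : L) : q (U x y) z + q y (U x z) = 0

/-- The curvature `R(x, y) z` of the left-invariant connection `U`. -/
def algebraicCurvature (U : L → L → L) (x y z : L) : L :=
  U x (U y z) - U y (U x z) - U ⁅x, y⁆ z

/-- The Ricci operator `Ric v = ∑ᵢ R(v, eᵢ) eᵢ` of the left-invariant connection `U`, computed in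
the frame `e`. -/
def algebraicRicci (U : L → L → L) {ι : Type*} [Fintype ι] (e : ι → L) (v : L) : L :=
  ∑ i, algebraicCurvature U v (e i) (e i)

namespace IsAlgebraicLeviCivita

lemma koszul (hU : IsAlgebraicLeviCivita q U) (hq : IsInnerProduct q) (x y z : L) :
    2 * q (U x y) z = q ⁅x, y⁆ z - q ⁅y, z⁆ x + q ⁅z, x⁆ y := by
  have hxyz := hU.metric x y z
  have hyzx := hU.metric y z x
  have hzxy := hU.metric z x y
  rw [hq.symm y] at hxyz
  rw [hq.symm z] at hyzx
  rw [hq.symm x] at hzxy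
  simp only [← hU.torsion, map_sub, LinearMap.sub_apply]
  linarith

lemma unique {U' : L → L → L} (hU : IsAlgebraicLeviCivita q U) (hq : IsInnerProduct q)
    (hU' : IsAlgebraicLeviCivita q U') (x y : L) : U x y = U' x y :=
  hq.ext fun z ↦ by linarith [hU.koszul hq x y z, hU'.koszul hq x y z]

lemma apply_sub_smul (hU : IsAlgebraicLeviCivita q U) (hq : IsInnerProduct q)
    (x y z : L) (t : ℝ) : U x (y - t • z) = U x y - t • U x z := by
  refine hq.ext fun w ↦ ?_
  have h := hU.metric x (y - t • z) w
  simp only [map_sub, map_smul, LinearMap.sub_apply, LinearMap.smul_apply, smul_eq_mul] at h ⊢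
  linear_combination h - hU.metric x y w + t * hU.metric x z w

lemma apply_zero (hU : IsAlgebraicLeviCivita q U) (hq : IsInnerProduct q) (x : L) : U x 0 = 0 := by
  simpa using hU.apply_sub_smul hq x 0 0 1

lemma apply_self_eq_zero (hU : IsAlgebraicLeviCivita q U) (hq : IsInnerProduct q) (x y : L) :
    q (U x y) y = 0 := by
  have := hU.metric x y y
  rw [hq.symm y] at this
  linarith

end IsAlgebraicLeviCivita

end MetricLieAlgebras

section CodimensionOne

variable {𝔟 : Type*} [LieRing 𝔟] [LieAlgebra ℝ 𝔟] {q : LinearMap.BilinForm ℝ 𝔟} {U : 𝔟 → 𝔟 → 𝔟}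
  {𝔰 : Type*} [LieRing 𝔰] [LieAlgebra ℝ 𝔰] {q' : LinearMap.BilinForm ℝ 𝔰} {V : 𝔰 → 𝔰 → 𝔰}
  {f : 𝔰 →ₗ⁅ℝ⁆ 𝔟} {A : 𝔟} {D : 𝔰 →ₗ[ℝ] 𝔰}

/-- The embedding `f` is isometric and has codimension one, with unit normal `A`. -/
structure IsUnitNormal (q : LinearMap.BilinForm ℝ 𝔟) (q' : LinearMap.BilinForm ℝ 𝔰)
    (f : 𝔰 →ₗ⁅ℝ⁆ 𝔟) (A : 𝔟) : Prop where
  injective : Function.Injective f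
  isometric (x y : 𝔰) : q' x y = q (f x) (f y)
  unit : q A A = 1
  normal (b : 𝔟) : q b A = 0 ↔ ∃ x, f x = b

namespace IsUnitNormal

lemma apply_normal (hA : IsUnitNormal q q' f A) (x : 𝔰) : q (f x) A = 0 :=
  (hA.normal _).2 ⟨x, rfl⟩

lemma exists_eq_sub_smul (hA : IsUnitNormal q q' f A) (b : 𝔟) : ∃ x, f x = b - q b A • A := by
  rw [← hA.normal, map_sub, LinearMap.sub_apply, map_smul, LinearMap.smul_apply, hA.unit,
    smul_eq_mul, mul_one, sub_self]

lemma isInnerProduct (hA : IsUnitNormal q q' f A) (hq : IsInnerProduct q) : IsInnerProduct q' where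
  symm x y := by rw [hA.isometric, hA.isometric, hq.symm]
  pos x hx := by
    rw [hA.isometric]
    exact hq.pos _ ((map_ne_zero_iff f hA.injective).2 hx)

/-- The frame of the ambient Lie algebra formed by the unit normal and a frame of the subalgebra. -/
def normalFrame (f : 𝔰 →ₗ⁅ℝ⁆ 𝔟) (A : 𝔟) {ι : Type*} (e : ι → 𝔰) : Option ι → 𝔟 :=
  fun o ↦ o.elim A (f ∘ e)

lemma isParsevalFrame_normalFrame (hA : IsUnitNormal q q' f A) (hq : IsInnerProduct q)
    {ι : Type*} [Fintype ι] {e : ι → 𝔰} (he : IsParsevalFrame q' e) :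
    IsParsevalFrame q (normalFrame f A e) := by
  intro b
  obtain ⟨x, hx⟩ := hA.exists_eq_sub_smul b
  have hb : b = f x + q b A • A := by rw [hx, sub_add_cancel]
  have hcoeff i : q b (f (e i)) = q' x (e i) := by
    rw [hb, map_add, map_smul, LinearMap.add_apply, LinearMap.smul_apply, hq.symm A,
      hA.apply_normal, smul_zero, add_zero, hA.isometric]
  have htangent : ∑ i, q b (f (e i)) • f (e i) = f x := by
    conv_rhs => rw [← he x, map_sum]
    simp only [hcoeff, map_smul]
  simp only [normalFrame, Fintype.sum_option, Option.elim, Function.comp_apply, htangent]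
  rw [add_comm, ← hb]

end IsUnitNormal

namespace IsAlgebraicLeviCivita

lemma apply_normal (hU : IsAlgebraicLeviCivita q U) (hUA : ∀ y, U A y = 0) (x : 𝔟) :
    U x A = -⁅A, x⁆ := by
  have := hU.torsion x A
  rwa [hUA, sub_zero, ← lie_skew] at this

lemma exists_map_eq_lie_normal (hU : IsAlgebraicLeviCivita q U) (hq : IsInnerProduct q)
    (hA : IsUnitNormal q q' f A) (hUA : ∀ y, U A y = 0) (x : 𝔰) : ∃ y, f y = ⁅A, f x⁆ := by
  rw [← hA.normal, ← neg_neg ⁅A, f x⁆, ← hU.apply_normal hUA, map_neg, LinearMap.neg_apply,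
    hU.apply_self_eq_zero hq, neg_zero]

lemma second_fundamental_form (hU : IsAlgebraicLeviCivita q U) (hq : IsInnerProduct q)
    (hA : IsUnitNormal q q' f A) (hUA : ∀ y, U A y = 0) (hD : ∀ x, f (D x) = ⁅A, f x⁆)
    (x y : 𝔰) : q (U (f x) (f y)) A = q' (D x) y := by
  have := hU.metric (f x) (f y) A
  rw [hU.apply_normal hUA, map_neg, hq.symm (f y), ← hD, ← hA.isometric] at this
  linarith

lemma second_fundamental_form_comm (hU : IsAlgebraicLeviCivita q U) (hq : IsInnerProduct q)
    (hA : IsUnitNormal q q' f A) (hUA : ∀ y, U A y = 0) (hD : ∀ x, f (D x) = ⁅A, f x⁆)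
    (x y : 𝔰) : q' (D x) y = q' (D y) x := by
  rw [← hU.second_fundamental_form hq hA hUA hD, ← hU.second_fundamental_form hq hA hUA hD,
    ← sub_eq_zero, ← LinearMap.sub_apply, ← map_sub, hU.torsion, ← LieHom.map_lie, hA.apply_normal]

theorem gauss_formula (hU : IsAlgebraicLeviCivita q U) (hV : IsAlgebraicLeviCivita q' V)
    (hq : IsInnerProduct q) (hA : IsUnitNormal q q' f A) (hUA : ∀ y, U A y = 0)
    (hD : ∀ x, f (D x) = ⁅A, f x⁆) (x y : 𝔰) :
    f (V x y) = U (f x) (f y) - q' (D x) y • A := by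
  choose W hW using fun x y ↦ hA.exists_eq_sub_smul (U (f x) (f y))
  simp only [hU.second_fundamental_form hq hA hUA hD] at hW
  have hW_levi : IsAlgebraicLeviCivita q' W := by
    refine ⟨fun x y ↦ hA.injective ?_, fun x y z ↦ ?_⟩
    · rw [map_sub, hW, hW, LieHom.map_lie, ← hU.torsion,
        hU.second_fundamental_form_comm hq hA hUA hD y]
      abel
    · rw [hA.isometric, hA.isometric, hW, hW]
      simpa only [map_sub, map_smul, LinearMap.sub_apply, LinearMap.smul_apply, hA.apply_normal,
        hq.symm A, smul_zero, sub_zero] using hU.metric (f x) (f y) (f z)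
  rw [hV.unique (hA.isInnerProduct hq) hW_levi, hW]

theorem gauss_equation (hU : IsAlgebraicLeviCivita q U) (hV : IsAlgebraicLeviCivita q' V)
    (hq : IsInnerProduct q) (hA : IsUnitNormal q q' f A) (hUA : ∀ y, U A y = 0)
    (hD : ∀ x, f (D x) = ⁅A, f x⁆) (x y z : 𝔰) :
    ∃ t : ℝ, f (algebraicCurvature V x y z) = algebraicCurvature U (f x) (f y) (f z) +
      q' (D y) z • f (D x) - q' (D x) z • f (D y) + t • A := by
  have h := hU.gauss_formula hV hq hA hUA hD
  refine ⟨-q' (D x) (V y z) + q' (D y) (V x z) + q' (D ⁅x, y⁆) z, ?_⟩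
  rw [algebraicCurvature, algebraicCurvature, map_sub, map_sub, h x (V y z), h y z, h y (V x z),
    h x z, h ⁅x, y⁆, hU.apply_sub_smul hq, hU.apply_sub_smul hq, hU.apply_normal hUA,
    hU.apply_normal hUA, hD, hD, LieHom.map_lie]
  module

lemma algebraicCurvature_normal (hU : IsAlgebraicLeviCivita q U) (hq : IsInnerProduct q)
    (hUA : ∀ y, U A y = 0) (hD : ∀ x, f (D x) = ⁅A, f x⁆) (x : 𝔰) :
    algebraicCurvature U (f x) A A = -f (D (D x)) := by
  rw [algebraicCurvature, hUA, hUA, hU.apply_zero hq, hU.apply_normal hUA, hD, hD,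
    ← lie_skew A (f x), lie_neg]
  abel

lemma exists_map_algebraicRicci [FiniteDimensional ℝ 𝔰] (hU : IsAlgebraicLeviCivita q U)
    (hV : IsAlgebraicLeviCivita q' V) (hq : IsInnerProduct q) (hA : IsUnitNormal q q' f A)
    (hUA : ∀ y, U A y = 0) (hD : ∀ x, f (D x) = ⁅A, f x⁆) {ι : Type*} [Fintype ι] {e : ι → 𝔰}
    (he : IsParsevalFrame q' e) (v : 𝔰) :
    ∃ t : ℝ, f (algebraicRicci V e v) = algebraicRicci U (IsUnitNormal.normalFrame f A e) (f v) +
      LinearMap.trace ℝ 𝔰 D • f (D v) + t • A := by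
  choose t ht using fun i ↦ hU.gauss_equation hV hq hA hUA hD v (e i) (e i)
  have hDD : ∑ i, q' (D v) (e i) • f (D (e i)) = f (D (D v)) := by
    conv_rhs => rw [← he (D v)]
    simp only [map_sum, map_smul]
  refine ⟨∑ i, t i, ?_⟩
  rw [algebraicRicci, algebraicRicci, Fintype.sum_option, map_sum]
  simp only [IsUnitNormal.normalFrame, Option.elim, Function.comp_apply, ht,
    hU.algebraicCurvature_normal hq hUA hD]
  rw [Finset.sum_add_distrib, Finset.sum_sub_distrib, Finset.sum_add_distrib, hDD,
    ← Finset.sum_smul, ← Finset.sum_smul, ← he.trace_eq]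
  abel

theorem algebraicRicci_of_einstein [FiniteDimensional ℝ 𝔰] (hU : IsAlgebraicLeviCivita q U)
    (hV : IsAlgebraicLeviCivita q' V) (hq : IsInnerProduct q) (hA : IsUnitNormal q q' f A)
    (hUA : ∀ y, U A y = 0) (hD : ∀ x, f (D x) = ⁅A, f x⁆) {ι : Type*} [Fintype ι] {e : ι → 𝔰}
    (he : IsParsevalFrame q' e) {k : ℝ}
    (hk : ∀ v, algebraicRicci U (IsUnitNormal.normalFrame f A e) v = k • v) (v : 𝔰) :
    algebraicRicci V e v = k • v + LinearMap.trace ℝ 𝔰 D • D v := by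
  obtain ⟨t, ht⟩ := hU.exists_map_algebraicRicci hV hq hA hUA hD he v
  rw [hk] at ht
  have ht_zero : t = 0 := by
    have := congrArg (fun x ↦ q x A) ht
    simpa only [map_add, LinearMap.add_apply, hA.apply_normal, map_smul, LinearMap.smul_apply,
      hA.unit, zero_add, smul_eq_mul, mul_one, mul_zero, eq_comm] using this
  apply hA.injective
  rw [ht, ht_zero, zero_smul, add_zero, map_add, map_smul, map_smul]

end IsAlgebraicLeviCivita

lemma exists_lieDerivation_map_eq_lie (hf : Function.Injective f)
    (h : ∀ x, ∃ y, f y = ⁅A, f x⁆) : ∃ D : LieDerivation ℝ 𝔰 𝔰, ∀ x, f (D x) = ⁅A, f x⁆ := by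
  choose D hD using h
  let D' : 𝔰 →ₗ[ℝ] 𝔰 :=
    { toFun := D
      map_add' := fun x y ↦ hf (by rw [hD, map_add, map_add, hD, hD, lie_add])
      map_smul' := fun c x ↦ hf (by rw [hD, map_smul, map_smul, hD, lie_smul, RingHom.id_apply]) }
  refine ⟨⟨D', fun x y ↦ hf ?_⟩, hD⟩
  change f (D ⁅x, y⁆) = f (⁅x, D y⁆ - ⁅y, D x⁆)
  rw [hD, map_sub, LieHom.map_lie, LieHom.map_lie, LieHom.map_lie, hD, hD, leibniz_lie,
    ← lie_skew (f y)]
  abel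

end CodimensionOne

section CartanDecomposition

variable {L : Type*} [LieRing L] [LieAlgebra ℝ L] {θ : L →ₗ⁅ℝ⁆ L}

/-- The projection to the `+1`-eigenspace `𝔨` of the involution `θ`. -/
def kPart (θ : L →ₗ⁅ℝ⁆ L) : L →ₗ[ℝ] L := (2⁻¹ : ℝ) • (LinearMap.id + θ.toLinearMap)

/-- The projection to the `-1`-eigenspace `𝔭` of the involution `θ`. -/
def pPart (θ : L →ₗ⁅ℝ⁆ L) : L →ₗ[ℝ] L := (2⁻¹ : ℝ) • (LinearMap.id - θ.toLinearMap)

lemma kPart_apply (θ : L →ₗ⁅ℝ⁆ L) (X : L) : kPart θ X = (2⁻¹ : ℝ) • (X + θ X) := rfl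

lemma pPart_apply (θ : L →ₗ⁅ℝ⁆ L) (X : L) : pPart θ X = (2⁻¹ : ℝ) • (X - θ X) := rfl

lemma kPart_add_pPart (θ : L →ₗ⁅ℝ⁆ L) (X : L) : kPart θ X + pPart θ X = X := by
  rw [kPart_apply, pPart_apply]
  module

lemma kPart_eq_zero_iff {X : L} : kPart θ X = 0 ↔ θ X = -X := by
  rw [kPart_apply, smul_eq_zero_iff_right (by norm_num), ← eq_neg_iff_add_eq_zero, eq_comm,
    neg_eq_iff_eq_neg, eq_comm]

lemma pPart_eq_self {X : L} (hX : θ X = -X) : pPart θ X = X := by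
  rw [pPart_apply, hX]
  module

lemma map_kPart (hθ : Function.Involutive θ) (X : L) : θ (kPart θ X) = kPart θ X := by
  rw [kPart_apply, map_smul, map_add, hθ, add_comm]

lemma map_pPart (hθ : Function.Involutive θ) (X : L) : θ (pPart θ X) = -pPart θ X := by
  rw [pPart_apply, map_smul, map_sub, hθ, ← smul_neg, neg_sub]

lemma kPart_lie (X Y : L) :
    kPart θ ⁅X, Y⁆ = ⁅kPart θ X, kPart θ Y⁆ + ⁅pPart θ X, pPart θ Y⁆ := by
  simp only [kPart_apply, pPart_apply, LieHom.map_lie, smul_lie, lie_smul, lie_add, add_lie,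
    lie_sub, sub_lie]
  module

lemma pPart_lie (X Y : L) :
    pPart θ ⁅X, Y⁆ = ⁅kPart θ X, pPart θ Y⁆ + ⁅pPart θ X, kPart θ Y⁆ := by
  simp only [kPart_apply, pPart_apply, LieHom.map_lie, smul_lie, lie_smul, lie_add, add_lie,
    lie_sub, sub_lie]
  module

lemma map_lie_lie_eq_neg {X Y Z : L} (hX : θ X = -X) (hY : θ Y = -Y) (hZ : θ Z = -Z) :
    θ ⁅⁅X, Y⁆, Z⁆ = -⁅⁅X, Y⁆, Z⁆ := by
  simp only [LieHom.map_lie, hX, hY, hZ, lie_neg, neg_lie, neg_neg]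

lemma killingForm_lie (X Y Z : L) : killingForm ℝ L ⁅X, Y⁆ Z = -killingForm ℝ L Y ⁅X, Z⁆ :=
  LieModule.traceForm_apply_lie_apply' ℝ L L X Y Z

lemma killingForm_comm (X Y : L) : killingForm ℝ L X Y = killingForm ℝ L Y X :=
  LieModule.traceForm_comm ℝ L L X Y

lemma killingForm_lie_lie (X Y Z : L) :
    killingForm ℝ L ⁅X, ⁅Y, Z⁆⁆ Z = killingForm ℝ L ⁅⁅Y, Z⁆, Z⁆ X := by
  rw [killingForm_lie ⁅Y, Z⁆, ← lie_skew, map_neg, LinearMap.neg_apply, killingForm_comm]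

lemma killingForm_lie_lie' (X Y Z : L) :
    killingForm ℝ L ⁅X, ⁅Y, Z⁆⁆ Z = killingForm ℝ L ⁅⁅X, Z⁆, Z⁆ Y := by
  rw [← killingForm_lie_lie, killingForm_lie X, killingForm_lie Y ⁅X, Z⁆, killingForm_comm]

theorem killingForm_eq_trace_comp_pPart [FiniteDimensional ℝ L] (X : L) {Y : L} (hY : θ Y = -Y) :
    killingForm ℝ L X Y =
      LinearMap.trace ℝ L ((LieAlgebra.ad ℝ L X ∘ₗ LieAlgebra.ad ℝ L Y) ∘ₗ pPart θ) +
        LinearMap.trace ℝ L ((LieAlgebra.ad ℝ L Y ∘ₗ LieAlgebra.ad ℝ L X) ∘ₗ pPart θ) := by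
  have hswap : LieAlgebra.ad ℝ L Y ∘ₗ kPart θ = pPart θ ∘ₗ LieAlgebra.ad ℝ L Y := by
    ext Z
    simp only [LinearMap.comp_apply, LieAlgebra.ad_apply, pPart_lie, kPart_eq_zero_iff.2 hY,
      pPart_eq_self hY, zero_lie, zero_add]
  have hsplit : LieAlgebra.ad ℝ L X ∘ₗ LieAlgebra.ad ℝ L Y =
      (LieAlgebra.ad ℝ L X ∘ₗ LieAlgebra.ad ℝ L Y) ∘ₗ pPart θ +
        (LieAlgebra.ad ℝ L X ∘ₗ pPart θ) ∘ₗ LieAlgebra.ad ℝ L Y := by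
    rw [LinearMap.comp_assoc _ (pPart θ), ← hswap]
    ext Z
    simp only [LinearMap.add_apply, LinearMap.comp_apply]
    rw [← map_add, ← map_add, add_comm, kPart_add_pPart]
  calc killingForm ℝ L X Y
      = LinearMap.trace ℝ L (LieAlgebra.ad ℝ L X ∘ₗ LieAlgebra.ad ℝ L Y) :=
        killingForm_apply_apply ..
    _ = LinearMap.trace ℝ L ((LieAlgebra.ad ℝ L X ∘ₗ LieAlgebra.ad ℝ L Y) ∘ₗ pPart θ) +
          LinearMap.trace ℝ L ((LieAlgebra.ad ℝ L X ∘ₗ pPart θ) ∘ₗ LieAlgebra.ad ℝ L Y) := by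
        conv_lhs => rw [hsplit, map_add]
    _ = _ := by rw [LinearMap.trace_comp_comm' (LieAlgebra.ad ℝ L Y),
        LinearMap.comp_assoc (pPart θ) (LieAlgebra.ad ℝ L X)]

/-- `θ` is a Cartan involution; in particular `L` is semisimple. -/
structure IsCartanInvolution (θ : L →ₗ⁅ℝ⁆ L) : Prop where
  involutive : Function.Involutive θ
  cartan (X : L) : X ≠ 0 → 0 < -killingForm ℝ L (θ X) X

namespace IsCartanInvolution

lemma killingForm_map_left (hθ : IsCartanInvolution θ) (X Y : L) :
    killingForm ℝ L (θ X) Y = killingForm ℝ L X (θ Y) := by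
  let e : L ≃ₗ⁅ℝ⁆ L :=
    { θ with
      invFun := θ
      left_inv := hθ.involutive
      right_inv := hθ.involutive }
  rw [← LieAlgebra.killingForm_of_equiv_apply e]
  exact congrArg (fun Z ↦ killingForm ℝ L Z (θ Y)) (hθ.involutive X)

lemma killingForm_pPart_left (hθ : IsCartanInvolution θ) (X Y : L) :
    killingForm ℝ L (pPart θ X) Y = killingForm ℝ L X (pPart θ Y) := by
  simp only [pPart_apply, map_smul, map_sub, LinearMap.smul_apply, LinearMap.sub_apply,
    hθ.killingForm_map_left]

lemma killingForm_pos (hθ : IsCartanInvolution θ) {X : L} (hX : θ X = -X) (hne : X ≠ 0) :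
    0 < killingForm ℝ L X X := by
  have := hθ.cartan X hne
  rwa [hX, map_neg, LinearMap.neg_apply, neg_neg] at this

lemma isInnerProduct_restrict (hθ : IsCartanInvolution θ) :
    IsInnerProduct ((killingForm ℝ L).restrict (LinearMap.ker (kPart θ))) where
  symm X Y := killingForm_comm _ _
  pos X hX := hθ.killingForm_pos (kPart_eq_zero_iff.1 X.2) (by simpa using hX)

lemma isInnerProduct_neg_comp (hθ : IsCartanInvolution θ) :
    IsInnerProduct (-(killingForm ℝ L).comp θ.toLinearMap LinearMap.id) where
  symm X Y := congrArg Neg.neg ((hθ.killingForm_map_left X Y).trans (killingForm_comm _ _))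
  pos := hθ.cartan

end IsCartanInvolution

end CartanDecomposition

section InvariantMetrics

variable {L : Type*} [LieRing L] [LieAlgebra ℝ L] {θ : L →ₗ⁅ℝ⁆ L} {Q : LinearMap.BilinForm ℝ L}

/-- `Q` is the extension by zero to `L = 𝔨 ⊕ 𝔭` of a `𝔨`-invariant inner product on `𝔭`. -/
structure IsInvariantMetric (θ : L →ₗ⁅ℝ⁆ L) (Q : LinearMap.BilinForm ℝ L) : Prop where
  symm (X Y : L) : Q X Y = Q Y X
  pos (X : L) : θ X ≠ X → 0 < Q X X
  vertical (X Y : L) : θ X = X → Q X Y = 0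
  invariant (Z X Y : L) : θ Z = Z → Q ⁅Z, X⁆ Y + Q X ⁅Z, Y⁆ = 0

/-- The representation of `𝔨` on `𝔭` is irreducible. -/
structure IsIsotropyIrreducible (θ : L →ₗ⁅ℝ⁆ L) : Prop where
  nontrivial : LinearMap.ker (kPart θ) ≠ ⊥
  irreducible (W : Submodule ℝ L) : W ≤ LinearMap.ker (kPart θ) →
    (∀ X Y : L, θ X = X → Y ∈ W → ⁅X, Y⁆ ∈ W) → W = ⊥ ∨ W = LinearMap.ker (kPart θ)

namespace IsInvariantMetric

lemma apply_pPart (hQ : IsInvariantMetric θ Q) (hθ : Function.Involutive θ) (X Y : L) :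
    Q (pPart θ X) Y = Q X Y := by
  conv_rhs => rw [← kPart_add_pPart θ X, map_add, LinearMap.add_apply,
    hQ.vertical _ _ (map_kPart hθ X), zero_add]

lemma apply_pPart_right (hQ : IsInvariantMetric θ Q) (hθ : Function.Involutive θ) (X Y : L) :
    Q X (pPart θ Y) = Q X Y := by
  rw [hQ.symm, hQ.apply_pPart hθ, hQ.symm]

lemma apply_eq_mul_killingForm_iff (hQ : IsInvariantMetric θ Q) (hθ : IsCartanInvolution θ)
    {X : L} (hX : θ X = -X) (c : ℝ) :
    X ∈ LinearMap.ker (Q - c • killingForm ℝ L) ↔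
      ∀ Y, θ Y = -Y → Q X Y = c * killingForm ℝ L X Y := by
  have hker : X ∈ LinearMap.ker (Q - c • killingForm ℝ L) ↔
      ∀ Y, Q X Y = c * killingForm ℝ L X Y := by
    rw [LinearMap.mem_ker, LinearMap.ext_iff]
    exact forall_congr' fun Y ↦ sub_eq_zero
  refine hker.trans ⟨fun h Y _ ↦ h Y, fun h Y ↦ ?_⟩
  have := h _ (map_pPart hθ.involutive Y)
  rwa [hQ.apply_pPart_right hθ.involutive, ← hθ.killingForm_pPart_left, pPart_eq_self hX] at this

lemma lie_mem_ker_sub (hQ : IsInvariantMetric θ Q) {c : ℝ} {X Z : L} (hZ : θ Z = Z)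
    (hX : X ∈ LinearMap.ker (Q - c • killingForm ℝ L)) :
    ⁅Z, X⁆ ∈ LinearMap.ker (Q - c • killingForm ℝ L) := by
  ext Y
  have hXZY : Q X ⁅Z, Y⁆ = c * killingForm ℝ L X ⁅Z, Y⁆ :=
    sub_eq_zero.1 (LinearMap.congr_fun hX ⁅Z, Y⁆)
  change Q ⁅Z, X⁆ Y - c * killingForm ℝ L ⁅Z, X⁆ Y = 0
  rw [killingForm_lie]
  linarith [hQ.invariant Z X Y hZ]

theorem exists_eq_killingForm [FiniteDimensional ℝ L] (hQ : IsInvariantMetric θ Q)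
    (hθ : IsCartanInvolution θ) (hirr : IsIsotropyIrreducible θ) :
    ∃ c : ℝ, 0 < c ∧ ∀ X Y, Q X Y = c * killingForm ℝ L (pPart θ X) Y := by
  have : Nontrivial (LinearMap.ker (kPart θ)) :=
    Submodule.nontrivial_iff_ne_bot.2 hirr.nontrivial
  obtain ⟨c, v, hv, hc⟩ := hθ.isInnerProduct_restrict.exists_relative_eigenvector
    (Q := Q.restrict (LinearMap.ker (kPart θ))) fun x y ↦ hQ.symm _ _
  have hvθ := kPart_eq_zero_iff.1 v.2
  have hv_mem : (v : L) ∈ LinearMap.ker (Q - c • killingForm ℝ L) :=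
    (hQ.apply_eq_mul_killingForm_iff hθ hvθ c).2 fun Y hY ↦ hc ⟨Y, kPart_eq_zero_iff.2 hY⟩
  -- Schur's lemma: the eigenspace of `Q` relative to the Killing form is `𝔨`-invariant
  have hW := (hirr.irreducible
    (LinearMap.ker (kPart θ) ⊓ LinearMap.ker (Q - c • killingForm ℝ L)) inf_le_left
    fun Z X hZ hX ↦ ⟨by
      rw [SetLike.mem_coe, LinearMap.mem_ker, kPart_eq_zero_iff, LieHom.map_lie, hZ,
        kPart_eq_zero_iff.1 hX.1, lie_neg], hQ.lie_mem_ker_sub hZ hX.2⟩).resolve_left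
    fun hbot ↦ hv (by simpa using hbot.le ⟨v.2, hv_mem⟩)
  have hQc X Y : Q X Y = c * killingForm ℝ L (pPart θ X) Y := by
    have hX : pPart θ X ∈ LinearMap.ker (Q - c • killingForm ℝ L) :=
      (hW.ge (kPart_eq_zero_iff.2 (map_pPart hθ.involutive X))).2
    rw [← hQ.apply_pPart hθ.involutive]
    exact sub_eq_zero.1 (LinearMap.congr_fun hX Y)
  have hv_ne : (v : L) ≠ 0 := by simpa using hv
  have hQv : 0 < Q v v := hQ.pos v fun h ↦ hv_ne <| by
    rw [← pPart_eq_self hvθ, pPart_apply, h, sub_self, smul_zero]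
  rw [hQc, pPart_eq_self hvθ] at hQv
  exact ⟨c, (pos_iff_pos_of_mul_pos hQv).2 (hθ.killingForm_pos hvθ hv_ne), hQc⟩

end IsInvariantMetric

end InvariantMetrics

section SimplyTransitive

variable {L : Type*} [LieRing L] [LieAlgebra ℝ L] {θ : L →ₗ⁅ℝ⁆ L} {Q : LinearMap.BilinForm ℝ L}
  {𝔟 : Type*} [LieRing 𝔟] [LieAlgebra ℝ 𝔟] {J : 𝔟 →ₗ⁅ℝ⁆ L} {q : LinearMap.BilinForm ℝ 𝔟}
  {U : 𝔟 → 𝔟 → 𝔟} {ι : Type*} [Fintype ι] {e : ι → 𝔟} {c : ℝ}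

/-- `J` presents `𝔟` as the Lie algebra of a group acting simply transitively on the symmetric
space with metric `Q`, and `q` is the metric pulled back to that group. -/
structure IsSimplyTransitive (θ : L →ₗ⁅ℝ⁆ L) (Q : LinearMap.BilinForm ℝ L) (J : 𝔟 →ₗ⁅ℝ⁆ L)
    (q : LinearMap.BilinForm ℝ 𝔟) : Prop where
  eq_pullback (x y : 𝔟) : q x y = Q (J x) (J y)
  isInnerProduct : IsInnerProduct q
  surjective (X : L) : ∃ x, pPart θ (J x) = pPart θ X

namespace IsSimplyTransitive

lemma pPart_injective (hJ : IsSimplyTransitive θ Q J q) (hQ : IsInvariantMetric θ Q)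
    (hθ : Function.Involutive θ) {x y : 𝔟} (h : pPart θ (J x) = pPart θ (J y)) : x = y :=
  hJ.isInnerProduct.ext fun z ↦ by
    rw [hJ.eq_pullback, hJ.eq_pullback, ← hQ.apply_pPart hθ, h, hQ.apply_pPart hθ]

theorem pPart_connection (hJ : IsSimplyTransitive θ Q J q) (hQ : IsInvariantMetric θ Q)
    (hθ : Function.Involutive θ) (hU : IsAlgebraicLeviCivita q U) (x y : 𝔟) :
    pPart θ (J (U x y)) = ⁅kPart θ (J x), pPart θ (J y)⁆ := by
  have hmem x y : pPart θ ⁅kPart θ (J x), pPart θ (J y)⁆ = ⁅kPart θ (J x), pPart θ (J y)⁆ :=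
    pPart_eq_self (by rw [LieHom.map_lie, map_kPart hθ, map_pPart hθ, lie_neg])
  choose W hW using fun x y ↦ hJ.surjective ⁅kPart θ (J x), pPart θ (J y)⁆
  simp only [hmem] at hW
  have hW_levi : IsAlgebraicLeviCivita q W := by
    refine ⟨fun x y ↦ hJ.pPart_injective hQ hθ ?_, fun x y z ↦ ?_⟩
    · rw [map_sub, map_sub, LieHom.map_lie, pPart_lie, hW, hW, ← lie_skew (kPart θ (J y)),
        sub_neg_eq_add]
    · rw [hJ.eq_pullback, hJ.eq_pullback, ← hQ.apply_pPart hθ, hW,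
        ← hQ.apply_pPart_right hθ (J y), hW, ← hQ.apply_pPart_right hθ _ (J z),
        ← hQ.apply_pPart hθ (J y)]
      exact hQ.invariant _ _ _ (map_kPart hθ _)
  rw [hU.unique hJ.isInnerProduct hW_levi, hW]

lemma connection_eq_zero (hJ : IsSimplyTransitive θ Q J q) (hQ : IsInvariantMetric θ Q)
    (hθ : Function.Involutive θ) (hU : IsAlgebraicLeviCivita q U) {a : 𝔟} (ha : θ (J a) = -J a)
    (y : 𝔟) : U a y = 0 :=
  hJ.pPart_injective hQ hθ <| by
    rw [hJ.pPart_connection hQ hθ hU, kPart_eq_zero_iff.2 ha, zero_lie, map_zero, map_zero]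

theorem pPart_curvature (hJ : IsSimplyTransitive θ Q J q) (hQ : IsInvariantMetric θ Q)
    (hθ : Function.Involutive θ) (hU : IsAlgebraicLeviCivita q U) (x y z : 𝔟) :
    pPart θ (J (algebraicCurvature U x y z)) =
      -⁅⁅pPart θ (J x), pPart θ (J y)⁆, pPart θ (J z)⁆ := by
  have hconn := hJ.pPart_connection hQ hθ hU
  rw [algebraicCurvature, map_sub, map_sub, map_sub, map_sub, hconn, hconn, hconn, hconn, hconn,
    LieHom.map_lie, kPart_lie, add_lie, lie_lie (kPart θ (J x))]
  abel

lemma pPart_eq_sum (hJ : IsSimplyTransitive θ Q J q) (hQ : IsInvariantMetric θ Q)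
    (hθ : Function.Involutive θ) (he : IsParsevalFrame q e) (X : L) :
    pPart θ X = ∑ i, Q X (pPart θ (J (e i))) • pPart θ (J (e i)) := by
  obtain ⟨x, hx⟩ := hJ.surjective X
  conv_lhs => rw [← hx, ← he x, map_sum, map_sum]
  refine Finset.sum_congr rfl fun i _ ↦ ?_
  rw [map_smul, map_smul, hJ.eq_pullback, ← hQ.apply_pPart hθ, hx, hQ.apply_pPart hθ,
    hQ.apply_pPart_right hθ]

lemma trace_comp_pPart [FiniteDimensional ℝ L] (hJ : IsSimplyTransitive θ Q J q)
    (hQ : IsInvariantMetric θ Q) (hθ : Function.Involutive θ) (he : IsParsevalFrame q e)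
    (T : L →ₗ[ℝ] L) :
    LinearMap.trace ℝ L (T ∘ₗ pPart θ) =
      ∑ i, Q (T (pPart θ (J (e i)))) (pPart θ (J (e i))) :=
  trace_comp_eq_sum (φ := fun i ↦ Q.flip (pPart θ (J (e i)))) (hJ.pPart_eq_sum hQ hθ he) T

lemma killingForm_eq_sum [FiniteDimensional ℝ L] (hJ : IsSimplyTransitive θ Q J q)
    (hQ : IsInvariantMetric θ Q) (hθ : IsCartanInvolution θ)
    (hc : ∀ X Y, Q X Y = c * killingForm ℝ L (pPart θ X) Y) (he : IsParsevalFrame q e)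
    (X : L) {Y : L} (hY : θ Y = -Y) :
    killingForm ℝ L X Y =
      2 * c * killingForm ℝ L (∑ i, ⁅⁅X, pPart θ (J (e i))⁆, pPart θ (J (e i))⁆) Y := by
  have hQ_self (Z : L) i : Q Z (pPart θ (J (e i))) = c * killingForm ℝ L Z (pPart θ (J (e i))) := by
    rw [hc, hθ.killingForm_pPart_left, pPart_eq_self (map_pPart hθ.involutive _)]
  rw [killingForm_eq_trace_comp_pPart X hY, hJ.trace_comp_pPart hQ hθ.involutive he,
    hJ.trace_comp_pPart hQ hθ.involutive he, map_sum, LinearMap.sum_apply, Finset.mul_sum,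
    ← Finset.sum_add_distrib]
  refine Finset.sum_congr rfl fun i _ ↦ ?_
  simp only [LinearMap.comp_apply, LieAlgebra.ad_apply, hQ_self]
  rw [killingForm_lie_lie', killingForm_lie_lie]
  ring

lemma eq_smul_sum_lie_lie [FiniteDimensional ℝ L] (hJ : IsSimplyTransitive θ Q J q)
    (hQ : IsInvariantMetric θ Q) (hθ : IsCartanInvolution θ)
    (hc : ∀ X Y, Q X Y = c * killingForm ℝ L (pPart θ X) Y) (he : IsParsevalFrame q e)
    {X : L} (hX : θ X = -X) :
    X = (2 * c) • ∑ i, ⁅⁅X, pPart θ (J (e i))⁆, pPart θ (J (e i))⁆ := by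
  set Z := ∑ i, ⁅⁅X, pPart θ (J (e i))⁆, pPart θ (J (e i))⁆ with hZ_def
  have hZ : θ Z = -Z := by
    rw [hZ_def, map_sum, ← Finset.sum_neg_distrib]
    exact Finset.sum_congr rfl fun i _ ↦
      map_lie_lie_eq_neg hX (map_pPart hθ.involutive _) (map_pPart hθ.involutive _)
  have hdiff : θ (X - (2 * c) • Z) = -(X - (2 * c) • Z) := by
    rw [map_sub, map_smul, hX, hZ]
    module
  by_contra hne
  refine (hθ.killingForm_pos hdiff (sub_ne_zero.2 hne)).ne' ?_
  rw [LinearMap.map_sub₂, hJ.killingForm_eq_sum hQ hθ hc he X hdiff, LinearMap.map_smul₂,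
    smul_eq_mul, sub_self]

theorem algebraicRicci_eq [FiniteDimensional ℝ L] (hJ : IsSimplyTransitive θ Q J q)
    (hQ : IsInvariantMetric θ Q) (hθ : IsCartanInvolution θ) (hc_ne : c ≠ 0)
    (hc : ∀ X Y, Q X Y = c * killingForm ℝ L (pPart θ X) Y) (hU : IsAlgebraicLeviCivita q U)
    (he : IsParsevalFrame q e) (v : 𝔟) : algebraicRicci U e v = (-(2 * c)⁻¹) • v := by
  refine hJ.pPart_injective hQ hθ.involutive ?_
  rw [algebraicRicci, map_sum, map_sum, map_smul, map_smul]
  simp only [hJ.pPart_curvature hQ hθ.involutive hU, Finset.sum_neg_distrib]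
  conv_rhs => rw [hJ.eq_smul_sum_lie_lie hQ hθ hc he (map_pPart hθ.involutive (J v))]
  rw [smul_smul, neg_mul, inv_mul_cancel₀ (mul_ne_zero two_ne_zero hc_ne), neg_smul, one_smul]

end IsSimplyTransitive

end SimplyTransitive

section Solvability

variable {V : Type*} [AddCommGroup V] [Module ℝ V] {P : Set V}

lemma IsPositivity.add_ne_zero (hP : IsPositivity P) {v w : V} (hv : v ∈ P) (hw : w ∈ P)
    (hv_ne : v ≠ 0) : v + w ≠ 0 := by
  intro h
  rw [← neg_eq_of_add_eq_zero_right h] at hw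
  exact (hP.xor v hv_ne).elim (fun h ↦ h.2 hw) fun h ↦ h.2 hv

/-- The elements of `R` which are strictly below `v` in the ordering of `V` with positive
elements `P`; their number serves as the height of `v`. -/
def strictlyBelow (P R : Set V) (v : V) : Set V := {w ∈ R | v - w ∈ P ∧ v ≠ w}

lemma IsPositivity.ncard_strictlyBelow_lt (hP : IsPositivity P) {R : Set V} (hR : R.Finite)
    {v w : V} (hv : v ∈ R) (hw : w ∈ P) (hw_ne : w ≠ 0) :
    (strictlyBelow P R v).ncard < (strictlyBelow P R (v + w)).ncard := by
  refine Set.ncard_lt_ncard ⟨?_, fun h ↦ ?_⟩ (hR.subset fun _ h ↦ h.1)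
  · rintro u ⟨hu, hvu, -⟩
    have hsub : v + w - u = w + (v - u) := by abel
    refine ⟨hu, hsub ▸ hP.add _ hw _ hvu, fun heq ↦ ?_⟩
    exact hP.add_ne_zero hw hvu hw_ne (by rw [← hsub, heq, sub_self])
  · exact (h ⟨hv, by rwa [add_sub_cancel_left], by simpa using hw_ne⟩).2.2 rfl

variable {L : Type*} [LieRing L] [LieAlgebra ℝ L] {𝔰 : Type*} [LieRing 𝔰] [LieAlgebra ℝ 𝔰]
  {f : 𝔰 →ₗ⁅ℝ⁆ L}

lemma map_mem_of_mem_lie {I : LieIdeal ℝ 𝔰} {W W' : Submodule ℝ L} (hI : ∀ x ∈ I, f x ∈ W)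
    (hW : ∀ X ∈ W, ∀ Y ∈ W, ⁅X, Y⁆ ∈ W') {x : 𝔰} (hx : x ∈ ⁅I, I⁆) : f x ∈ W' := by
  rw [← LieSubmodule.mem_toSubmodule, LieSubmodule.lieIdeal_oper_eq_linear_span'] at hx
  refine (Submodule.span_le (p := W'.comap f.toLinearMap)).2 ?_ hx
  rintro _ ⟨x, hx, y, hy, rfl⟩
  change f ⁅x, y⁆ ∈ W'
  rw [LieHom.map_lie]
  exact hW _ (hI x hx) _ (hI y hy)

lemma isSolvable_of_filtration (hf : Function.Injective f) (W : ℕ → Submodule ℝ L)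
    (hf_mem : ∀ x, f x ∈ W 0) (hW : ∀ k, ∀ X ∈ W k, ∀ Y ∈ W k, ⁅X, Y⁆ ∈ W (k + 1))
    {n : ℕ} (hn : W n = ⊥) : LieAlgebra.IsSolvable 𝔰 := by
  have hderived k : ∀ x ∈ LieAlgebra.derivedSeries ℝ 𝔰 k, f x ∈ W k := by
    induction k with
    | zero => exact fun x _ ↦ hf_mem x
    | succ k ih =>
      intro x hx
      rw [LieAlgebra.derivedSeries_def, LieAlgebra.derivedSeriesOfIdeal_succ] at hx
      exact map_mem_of_mem_lie ih (hW k) hx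
  refine LieAlgebra.IsSolvable.mk (R := ℝ) (k := n) ((LieSubmodule.eq_bot_iff _).2 fun x hx ↦ ?_)
  have := hderived n x hx
  rwa [hn, Submodule.mem_bot, map_eq_zero_iff f hf] at this

end Solvability

section WeightSpaces

variable {L : Type*} [LieRing L] [LieAlgebra ℝ L]

/-- The root space `rootSpace 𝔞 l`, for an arbitrary Lie algebra. -/
def dualWeightSpace (𝔞 : Submodule ℝ L) (l : Module.Dual ℝ 𝔞) : Submodule ℝ L where
  carrier := {X | ∀ A : 𝔞, ⁅(A : L), X⁆ = l A • X}
  add_mem' hX hY A := by rw [lie_add, hX A, hY A, smul_add]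
  zero_mem' A := by simp
  smul_mem' c X hX A := by rw [lie_smul, hX A, smul_comm]

/-- The set of positive restricted roots. -/
def positiveRoots (𝔞 : Submodule ℝ L) (P : Set (Module.Dual ℝ 𝔞)) : Set (Module.Dual ℝ 𝔞) :=
  {l | l ≠ 0 ∧ dualWeightSpace 𝔞 l ≠ ⊥} ∩ P

/-- The sum of the root spaces of the roots in `R`. -/
def sumWeightSpaces (𝔞 : Submodule ℝ L) (R : Set (Module.Dual ℝ 𝔞)) : Submodule ℝ L :=
  ⨆ l ∈ R, dualWeightSpace 𝔞 l

variable {𝔞 : Submodule ℝ L} {P R R' : Set (Module.Dual ℝ 𝔞)}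

lemma le_sumWeightSpaces {l : Module.Dual ℝ 𝔞} (hl : l ∈ R) :
    dualWeightSpace 𝔞 l ≤ sumWeightSpaces 𝔞 R :=
  le_iSup₂ (f := fun l _ ↦ dualWeightSpace 𝔞 l) l hl

lemma mem_sumWeightSpaces_positiveRoots {l : Module.Dual ℝ 𝔞} (hlP : l ∈ P) (hl : l ≠ 0) {X : L}
    (hX : X ∈ dualWeightSpace 𝔞 l) : X ∈ sumWeightSpaces 𝔞 (positiveRoots 𝔞 P) := by
  rcases eq_or_ne X 0 with rfl | hX_ne
  · exact Submodule.zero_mem _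
  · exact le_sumWeightSpaces (R := positiveRoots 𝔞 P)
      ⟨⟨hl, (Submodule.ne_bot_iff _).2 ⟨X, hX, hX_ne⟩⟩, hlP⟩ hX

lemma lie_mem_dualWeightSpace {l m : Module.Dual ℝ 𝔞} {X Y : L} (hX : X ∈ dualWeightSpace 𝔞 l)
    (hY : Y ∈ dualWeightSpace 𝔞 m) : ⁅X, Y⁆ ∈ dualWeightSpace 𝔞 (l + m) := by
  intro A
  rw [leibniz_lie, hX A, hY A, smul_lie, lie_smul, LinearMap.add_apply, add_smul]

lemma lie_mem_of_mem_sumWeightSpaces {W : Submodule ℝ L}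
    (h : ∀ l ∈ R, ∀ m ∈ R', ∀ X ∈ dualWeightSpace 𝔞 l, ∀ Y ∈ dualWeightSpace 𝔞 m, ⁅X, Y⁆ ∈ W) :
    ∀ X ∈ sumWeightSpaces 𝔞 R, ∀ Y ∈ sumWeightSpaces 𝔞 R', ⁅X, Y⁆ ∈ W := by
  refine Submodule.map₂_le (f := (LieAlgebra.ad ℝ L : L →ₗ[ℝ] Module.End ℝ L)).1 ?_
  simp only [sumWeightSpaces, Submodule.map₂_iSup_left, Submodule.map₂_iSup_right, iSup_le_iff]
  exact fun m hm l hl ↦ Submodule.map₂_le.2 (h l hl m hm)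

lemma lie_mem_sumWeightSpaces {A X : L} (hA : A ∈ 𝔞) (hX : X ∈ sumWeightSpaces 𝔞 R) :
    ⁅A, X⁆ ∈ sumWeightSpaces 𝔞 R := by
  have hle : sumWeightSpaces 𝔞 R ≤ (sumWeightSpaces 𝔞 R).comap (LieAlgebra.ad ℝ L A) := by
    refine iSup₂_le fun l hl X hX ↦ ?_
    rw [Submodule.mem_comap, LieAlgebra.ad_apply, hX ⟨A, hA⟩]
    exact Submodule.smul_mem _ _ (le_sumWeightSpaces hl hX)
  exact hle hX

lemma finite_positiveRoots [FiniteDimensional ℝ L] (h𝔞 : ∀ X ∈ 𝔞, ∀ Y ∈ 𝔞, ⁅X, Y⁆ = 0) :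
    (positiveRoots 𝔞 P).Finite := by
  let K : LieSubalgebra ℝ L :=
    { 𝔞 with
      lie_mem' := fun {X Y} hX hY ↦ by
        rw [h𝔞 X hX Y hY]
        exact 𝔞.zero_mem }
  have hK : IsLieAbelian K := ⟨fun X Y ↦ Subtype.ext (h𝔞 X X.2 Y Y.2)⟩
  refine Set.Finite.of_finite_image (f := fun l : Module.Dual ℝ 𝔞 ↦ (l : K → ℝ))
    ((LieModule.finite_genWeightSpace_ne_bot ℝ K L).subset ?_) DFunLike.coe_injective.injOn
  rintro _ ⟨l, ⟨⟨-, hl⟩, -⟩, rfl⟩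
  obtain ⟨X, hX, hX_ne⟩ := Submodule.exists_mem_ne_zero_of_ne_bot hl
  intro hbot
  have hX_gen := LieModule.weightSpace_le_genWeightSpace L _
    ((LieModule.mem_weightSpace (fun A : K ↦ l A) X).2 hX)
  exact hX_ne (by rwa [hbot] at hX_gen)

/-- The filtration of `𝔞 ⊕ 𝔫` whose `k + 1`-st term is the sum of the root spaces of the positive
roots of height at least `k`. -/
def rootFiltration (𝔞 : Submodule ℝ L) (P : Set (Module.Dual ℝ 𝔞)) : ℕ → Submodule ℝ L
  | 0 => 𝔞 ⊔ sumWeightSpaces 𝔞 (positiveRoots 𝔞 P)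
  | k + 1 => sumWeightSpaces 𝔞
      {l ∈ positiveRoots 𝔞 P | k ≤ (strictlyBelow P (positiveRoots 𝔞 P) l).ncard}

lemma rootFiltration_one : rootFiltration 𝔞 P 1 = sumWeightSpaces 𝔞 (positiveRoots 𝔞 P) := by
  simp [rootFiltration]

lemma exists_rootFiltration_eq_bot (hR : (positiveRoots 𝔞 P).Finite) :
    ∃ k, rootFiltration 𝔞 P k = ⊥ := by
  refine ⟨(positiveRoots 𝔞 P).ncard + 2, eq_bot_iff.2 (iSup₂_le fun l hl ↦ ?_)⟩
  have := Set.ncard_le_ncard (s := strictlyBelow P (positiveRoots 𝔞 P) l) (fun _ h ↦ h.1) hR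
  have := hl.2
  omega

lemma lie_mem_rootFiltration_succ (hP : IsPositivity P) (hR : (positiveRoots 𝔞 P).Finite) (k : ℕ) :
    ∀ X ∈ rootFiltration 𝔞 P (k + 1), ∀ Y ∈ sumWeightSpaces 𝔞 (positiveRoots 𝔞 P),
      ⁅X, Y⁆ ∈ rootFiltration 𝔞 P (k + 2) := by
  refine lie_mem_of_mem_sumWeightSpaces ?_
  rintro l ⟨hl, hkl⟩ m hm X hX Y hY
  rcases eq_or_ne ⁅X, Y⁆ 0 with hzero | hne
  · rw [hzero]
    exact Submodule.zero_mem _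
  have hXY := lie_mem_dualWeightSpace hX hY
  have hroot : l + m ∈ positiveRoots 𝔞 P :=
    ⟨⟨hP.add_ne_zero hl.2 hm.2 hl.1.1, (Submodule.ne_bot_iff _).2 ⟨_, hXY, hne⟩⟩,
      hP.add _ hl.2 _ hm.2⟩
  have hheight := hP.ncard_strictlyBelow_lt hR hl hm.2 hm.1.1
  exact le_iSup₂_of_le (f := fun l _ ↦ dualWeightSpace 𝔞 l) (l + m) ⟨hroot, hkl.trans_lt hheight⟩
    le_rfl hXY

lemma rootFiltration_antitone : Antitone (rootFiltration 𝔞 P) := by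
  refine antitone_nat_of_succ_le fun k ↦ ?_
  cases k with
  | zero => exact rootFiltration_one.le.trans le_sup_right
  | succ k => exact biSup_mono fun l hl ↦ ⟨hl.1, k.le_succ.trans hl.2⟩

lemma lie_mem_rootFiltration (hP : IsPositivity P) (h𝔞 : ∀ X ∈ 𝔞, ∀ Y ∈ 𝔞, ⁅X, Y⁆ = 0)
    (hR : (positiveRoots 𝔞 P).Finite) (k : ℕ) :
    ∀ X ∈ rootFiltration 𝔞 P k, ∀ Y ∈ rootFiltration 𝔞 P k,
      ⁅X, Y⁆ ∈ rootFiltration 𝔞 P (k + 1) := by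
  intro X hX Y hY
  cases k with
  | zero =>
    obtain ⟨A, hA, N, hN, rfl⟩ := Submodule.mem_sup.1 hX
    obtain ⟨A', hA', N', hN', rfl⟩ := Submodule.mem_sup.1 hY
    have hNN' := lie_mem_rootFiltration_succ hP hR 0 N (rootFiltration_one.ge hN) N' hN'
    rw [lie_add, add_lie, add_lie, h𝔞 A hA A' hA', ← lie_skew N A', zero_add (-⁅A', N⁆),
      rootFiltration_one]
    exact Submodule.add_mem _ (Submodule.neg_mem _ (lie_mem_sumWeightSpaces hA' hN))
      (Submodule.add_mem _ (lie_mem_sumWeightSpaces hA hN')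
        (rootFiltration_one.le (rootFiltration_antitone one_le_two hNN')))
  | succ k =>
    exact lie_mem_rootFiltration_succ hP hR k X hX Y
      (rootFiltration_one.le (rootFiltration_antitone k.succ_pos hY))

theorem isSolvable_of_mem_sup [FiniteDimensional ℝ L] (hP : IsPositivity P)
    (h𝔞 : ∀ X ∈ 𝔞, ∀ Y ∈ 𝔞, ⁅X, Y⁆ = 0) {𝔰 : Type*} [LieRing 𝔰] [LieAlgebra ℝ 𝔰] {f : 𝔰 →ₗ⁅ℝ⁆ L}
    (hf : Function.Injective f)
    (hf_mem : ∀ x, f x ∈ 𝔞 ⊔ sumWeightSpaces 𝔞 (positiveRoots 𝔞 P)) : LieAlgebra.IsSolvable 𝔰 := by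
  have hR := finite_positiveRoots (P := P) h𝔞
  obtain ⟨n, hn⟩ := exists_rootFiltration_eq_bot hR
  exact isSolvable_of_filtration hf (rootFiltration 𝔞 P) hf_mem
    (lie_mem_rootFiltration hP h𝔞 hR) hn

end WeightSpaces

section Iwasawa

variable {L : Type*} [LieRing L] [LieAlgebra ℝ L] {θ : L →ₗ⁅ℝ⁆ L} {𝔞 : Submodule ℝ L}

/-- `𝔞` is a maximal abelian subspace of `𝔭`, with maximality expressed through the centralizer. -/
structure IsCartanSubspace (θ : L →ₗ⁅ℝ⁆ L) (𝔞 : Submodule ℝ L) : Prop where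
  odd : ∀ X ∈ 𝔞, θ X = -X
  abelian : ∀ X ∈ 𝔞, ∀ Y ∈ 𝔞, ⁅X, Y⁆ = 0
  centralizer (X : L) : θ X = -X → (∀ A ∈ 𝔞, ⁅A, X⁆ = 0) → X ∈ 𝔞

lemma mem_iSup_dualWeightSpace {χ : 𝔞 → ℝ} {X : L} (hX : ∀ A : 𝔞, ⁅(A : L), X⁆ = χ A • X) :
    X ∈ ⨆ l, dualWeightSpace 𝔞 l := by
  rcases eq_or_ne X 0 with rfl | hX_ne
  · exact Submodule.zero_mem _
  let l : Module.Dual ℝ 𝔞 :=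
    { toFun := χ
      map_add' := fun A B ↦ smul_left_injective ℝ hX_ne <| by
        simp only [add_smul, ← hX, Submodule.coe_add, add_lie]
      map_smul' := fun t A ↦ smul_left_injective ℝ hX_ne <| by
        simp only [RingHom.id_apply, smul_assoc, ← hX, Submodule.coe_smul, smul_lie] }
  exact Submodule.mem_iSup_of_mem l hX

namespace IsCartanSubspace

lemma map_mem_dualWeightSpace (h𝔞 : IsCartanSubspace θ 𝔞) {l : Module.Dual ℝ 𝔞} {X : L}
    (hX : X ∈ dualWeightSpace 𝔞 l) : θ X ∈ dualWeightSpace 𝔞 (-l) := by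
  intro A
  have := congrArg θ (hX A)
  rw [LieHom.map_lie, h𝔞.odd A A.2, neg_lie, map_smul] at this
  rw [LinearMap.neg_apply, neg_smul, ← this, neg_neg]

theorem iSup_dualWeightSpace_eq_top [FiniteDimensional ℝ L] (h𝔞 : IsCartanSubspace θ 𝔞)
    (hθ : IsCartanInvolution θ) : ⨆ l, dualWeightSpace 𝔞 l = ⊤ := by
  have hcommute (A B : 𝔞) : Commute (LieAlgebra.ad ℝ L (A : L)) (LieAlgebra.ad ℝ L (B : L)) := by
    ext X
    have := leibniz_lie (A : L) (B : L) X
    rwa [h𝔞.abelian A A.2 B B.2, zero_lie, zero_add] at this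
  have hsymm (A : 𝔞) (X Y : L) :
      -killingForm ℝ L (θ ⁅(A : L), X⁆) Y = -killingForm ℝ L (θ X) ⁅(A : L), Y⁆ := by
    rw [LieHom.map_lie, h𝔞.odd A A.2, neg_lie, map_neg, LinearMap.neg_apply, killingForm_lie,
      neg_neg]
  rw [eq_top_iff, ← hθ.isInnerProduct_neg_comp.iSup_iInf_eigenspace_eq_top hsymm hcommute]
  exact iSup_le fun χ X hX ↦ mem_iSup_dualWeightSpace fun A ↦
    Module.End.mem_eigenspace_iff.1 ((Submodule.mem_iInf _).1 hX A)

lemma pPart_mem (h𝔞 : IsCartanSubspace θ 𝔞) (hθ : Function.Involutive θ) {X : L}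
    (hX : X ∈ dualWeightSpace 𝔞 0) : pPart θ X ∈ 𝔞 := by
  refine h𝔞.centralizer _ (map_pPart hθ X) fun A hA ↦ ?_
  have hAX : ⁅A, X⁆ = 0 := by simpa using hX ⟨A, hA⟩
  have := kPart_lie (θ := θ) A X
  rw [hAX, map_zero, kPart_eq_zero_iff.2 (h𝔞.odd A hA), pPart_eq_self (h𝔞.odd A hA), zero_lie,
    zero_add] at this
  exact this.symm

variable {P : Set (Module.Dual ℝ 𝔞)}

theorem exists_mem_sup_pPart_eq [FiniteDimensional ℝ L] (h𝔞 : IsCartanSubspace θ 𝔞)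
    (hθ : IsCartanInvolution θ) (hP : IsPositivity P) (X : L) :
    ∃ Y ∈ 𝔞 ⊔ sumWeightSpaces 𝔞 (positiveRoots 𝔞 P), pPart θ Y = pPart θ X := by
  suffices h : ⨆ l, dualWeightSpace 𝔞 l ≤
      ((𝔞 ⊔ sumWeightSpaces 𝔞 (positiveRoots 𝔞 P)).map (pPart θ)).comap (pPart θ) from
    h (h𝔞.iSup_dualWeightSpace_eq_top hθ ▸ Submodule.mem_top)
  refine iSup_le fun l X hX ↦ ?_
  rcases eq_or_ne l 0 with rfl | hl
  · exact ⟨_, Submodule.mem_sup_left (h𝔞.pPart_mem hθ.involutive hX),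
      pPart_eq_self (map_pPart hθ.involutive X)⟩
  rcases hP.xor l hl with ⟨hpos, -⟩ | ⟨hneg, -⟩
  · exact ⟨X, Submodule.mem_sup_right (mem_sumWeightSpaces_positiveRoots hpos hl hX), rfl⟩
  · -- `-θ` reflects the negative root spaces onto the positive ones without changing `𝔭`-parts
    refine ⟨-θ X, Submodule.neg_mem _ (Submodule.mem_sup_right
      (mem_sumWeightSpaces_positiveRoots hneg (neg_ne_zero.2 hl)
        (h𝔞.map_mem_dualWeightSpace hX))), ?_⟩
    rw [map_neg, pPart_apply, pPart_apply, hθ.involutive, ← smul_neg, neg_sub]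

lemma killingForm_eq_zero (h𝔞 : IsCartanSubspace θ 𝔞) {A X : L} (hA : A ∈ 𝔞)
    (hX : X ∈ sumWeightSpaces 𝔞 (positiveRoots 𝔞 P)) : killingForm ℝ L X A = 0 := by
  suffices h : sumWeightSpaces 𝔞 (positiveRoots 𝔞 P) ≤
      LinearMap.ker ((killingForm ℝ L).flip A) from h hX
  refine iSup₂_le fun l hl X hX ↦ ?_
  obtain ⟨B, hB⟩ : ∃ B, l B ≠ 0 := by
    by_contra! hzero
    exact hl.1.1 (LinearMap.ext hzero)
  have := killingForm_lie (B : L) X A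
  rw [hX B, h𝔞.abelian B B.2 A hA, map_zero, neg_zero, LinearMap.map_smul₂, smul_eq_mul] at this
  exact (mul_eq_zero.1 this).resolve_left hB

variable {Q : LinearMap.BilinForm ℝ L} {𝔟 : Type*} [LieRing 𝔟] [LieAlgebra ℝ 𝔟] {J : 𝔟 →ₗ⁅ℝ⁆ L}
  {q : LinearMap.BilinForm ℝ 𝔟}

theorem isSimplyTransitive [FiniteDimensional ℝ L] (h𝔞 : IsCartanSubspace θ 𝔞)
    (hθ : IsCartanInvolution θ) (hP : IsPositivity P) (hq : IsInnerProduct q)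
    (hqQ : ∀ x y, q x y = Q (J x) (J y))
    (hJ : LinearMap.range J.toLinearMap = 𝔞 ⊔ sumWeightSpaces 𝔞 (positiveRoots 𝔞 P)) :
    IsSimplyTransitive θ Q J q where
  eq_pullback := hqQ
  isInnerProduct := hq
  surjective X := by
    obtain ⟨Y, hY, hYX⟩ := h𝔞.exists_mem_sup_pPart_eq hθ hP X
    rw [← hJ] at hY
    obtain ⟨x, rfl⟩ := hY
    exact ⟨x, hYX⟩

theorem isUnitNormal (h𝔞 : IsCartanSubspace θ 𝔞) (hθ : IsCartanInvolution θ) {c : ℝ}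
    (hc : ∀ X Y, Q X Y = c * killingForm ℝ L (pPart θ X) Y)
    (hqQ : ∀ x y, q x y = Q (J x) (J y))
    (hJ : LinearMap.range J.toLinearMap = 𝔞 ⊔ sumWeightSpaces 𝔞 (positiveRoots 𝔞 P))
    {A : 𝔟} (hA : J A ∈ 𝔞) (hA_unit : Q (J A) (J A) = 1) {𝔰 : Type*} [LieRing 𝔰] [LieAlgebra ℝ 𝔰]
    {f : 𝔰 →ₗ⁅ℝ⁆ 𝔟} {q' : LinearMap.BilinForm ℝ 𝔰} (hq' : ∀ x y, q' x y = q (f x) (f y))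
    (hf_inj : Function.Injective f)
    (hf : LinearMap.range f.toLinearMap = ((𝔞 ⊓ LinearMap.ker (Q.flip (J A))) ⊔
      sumWeightSpaces 𝔞 (positiveRoots 𝔞 P)).comap J.toLinearMap) :
    IsUnitNormal q q' f A where
  injective := hf_inj
  isometric := hq'
  unit := by rw [hqQ, hA_unit]
  normal b := by
    have horthogonal {N : L} (hN : N ∈ sumWeightSpaces 𝔞 (positiveRoots 𝔞 P)) : Q N (J A) = 0 := by
      rw [hc, hθ.killingForm_pPart_left, pPart_eq_self (h𝔞.odd _ hA),
        h𝔞.killingForm_eq_zero hA hN, mul_zero]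
    have hf_mem : (∃ x, f x = b) ↔ J b ∈ (𝔞 ⊓ LinearMap.ker (Q.flip (J A))) ⊔
        sumWeightSpaces 𝔞 (positiveRoots 𝔞 P) := (SetLike.ext_iff.1 hf b :)
    rw [hf_mem, hqQ]
    constructor
    · intro hb
      obtain ⟨X, hX, N, hN, hXN⟩ := Submodule.mem_sup.1 (hJ.le ⟨b, rfl⟩)
      change X + N = J b at hXN
      rw [← hXN, map_add, LinearMap.add_apply, horthogonal hN, add_zero] at hb
      exact Submodule.mem_sup.2 ⟨X, ⟨hX, hb⟩, N, hN, hXN⟩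
    · intro hb
      obtain ⟨X, ⟨-, hX⟩, N, hN, hXN⟩ := Submodule.mem_sup.1 hb
      rw [← hXN, map_add, LinearMap.add_apply, horthogonal hN, add_zero]
      exact hX

end IsCartanSubspace

end Iwasawa

section VectorFields

open VectorField Filter Topology

variable {E : Type*} [NormedAddCommGroup E] [NormedSpace ℝ E]
  {M : Type*} [TopologicalSpace M] [ChartedSpace E M]
  {F : Type*} [NormedAddCommGroup F] [NormedSpace ℝ F]

/-- The derivative of the vector-valued function `f` along the vector field `V`. -/
def fieldDeriv (f : M → F) (V : Π x : M, TangentSpace 𝓘(ℝ, E) x) (x : M) : F :=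
  mfderiv 𝓘(ℝ, E) 𝓘(ℝ, F) f x (V x)

/-- The vector field `V` read in the preferred chart at `x`. -/
def chartField (V : Π x : M, TangentSpace 𝓘(ℝ, E) x) (x : M) : E → E :=
  mpullback 𝓘(ℝ, E) 𝓘(ℝ, E) (extChartAt 𝓘(ℝ, E) x).symm V

variable [IsManifold 𝓘(ℝ, E) 2 M]

lemma contMDiffAt_extChartAt_symm {x : M} {u : E} (hu : u ∈ (extChartAt 𝓘(ℝ, E) x).target) :
    ContMDiffAt 𝓘(ℝ, E) 𝓘(ℝ, E) 2 (extChartAt 𝓘(ℝ, E) x).symm u :=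
  (contMDiffOn_extChartAt_symm x).contMDiffAt ((isOpen_extChartAt_target x).mem_nhds hu)

lemma isInvertible_mfderiv_extChartAt_symm {x : M} {u : E}
    (hu : u ∈ (extChartAt 𝓘(ℝ, E) x).target) :
    (mfderiv 𝓘(ℝ, E) 𝓘(ℝ, E) (extChartAt 𝓘(ℝ, E) x).symm u).IsInvertible := by
  simpa using isInvertible_mfderivWithin_extChartAt_symm hu

lemma fderiv_chartField {f : M → F} {x : M} {u : E} (V : Π x : M, TangentSpace 𝓘(ℝ, E) x)
    (hu : u ∈ (extChartAt 𝓘(ℝ, E) x).target)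
    (hf : MDifferentiableAt 𝓘(ℝ, E) 𝓘(ℝ, F) f ((extChartAt 𝓘(ℝ, E) x).symm u)) :
    fderiv ℝ (f ∘ (extChartAt 𝓘(ℝ, E) x).symm) u (chartField V x u) =
      fieldDeriv f V ((extChartAt 𝓘(ℝ, E) x).symm u) := by
  have hψ := (contMDiffAt_extChartAt_symm hu).mdifferentiableAt two_ne_zero
  rw [← mfderiv_eq_fderiv, mfderiv_comp u hf hψ]
  exact congrArg (mfderiv 𝓘(ℝ, E) 𝓘(ℝ, F) f _)
    ((isInvertible_mfderiv_extChartAt_symm hu).self_apply_inverse _)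

lemma contDiffAt_comp_extChartAt_symm {f : M → F} {x : M}
    (hf : ContMDiffAt 𝓘(ℝ, E) 𝓘(ℝ, F) 2 f x) :
    ContDiffAt ℝ 2 (f ∘ (extChartAt 𝓘(ℝ, E) x).symm) (extChartAt 𝓘(ℝ, E) x x) :=
  contMDiffAt_iff_contDiffAt.1 <| ContMDiffAt.comp _ (by rwa [extChartAt_to_inv])
    (contMDiffAt_extChartAt_symm (mem_extChartAt_target x))

lemma fderiv_chartField_eventuallyEq {f : M → F} {x : M} (W : Π x : M, TangentSpace 𝓘(ℝ, E) x)
    (hf : ContMDiffAt 𝓘(ℝ, E) 𝓘(ℝ, F) 2 f x) :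
    (fun u ↦ fderiv ℝ (f ∘ (extChartAt 𝓘(ℝ, E) x).symm) u (chartField W x u))
      =ᶠ[𝓝 (extChartAt 𝓘(ℝ, E) x x)] fieldDeriv f W ∘ (extChartAt 𝓘(ℝ, E) x).symm := by
  have hψ : Tendsto (extChartAt 𝓘(ℝ, E) x).symm (𝓝 (extChartAt 𝓘(ℝ, E) x x)) (𝓝 x) := by
    simpa only [ContinuousAt, extChartAt_to_inv] using
      continuousAt_extChartAt_symm (I := 𝓘(ℝ, E)) x
  filter_upwards [hψ ((contMDiffAt_iff_contMDiffAt_nhds (by simp)).1 hf),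
    extChartAt_target_mem_nhds x] with u hfu hu
  exact fderiv_chartField W hu (hfu.mdifferentiableAt two_ne_zero)

variable [CompleteSpace E] {x : M} {f : M → F} {V W : Π x : M, TangentSpace 𝓘(ℝ, E) x}

lemma differentiableAt_chartField
    (hV : MDiffAt (T% V) x) :
    DifferentiableAt ℝ (chartField V x) (extChartAt 𝓘(ℝ, E) x x) := by
  rw [← differentiableWithinAt_univ]
  simpa [chartField] using
    (mdifferentiableWithinAt_univ.2 hV).differentiableWithinAt_mpullbackWithin_vectorField

lemma differentiableAt_fderiv_chartField (hf : ContMDiffAt 𝓘(ℝ, E) 𝓘(ℝ, F) 2 f x)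
    (hW : MDiffAt (T% W) x) :
    DifferentiableAt ℝ (fun u ↦ fderiv ℝ (f ∘ (extChartAt 𝓘(ℝ, E) x).symm) u (chartField W x u))
      (extChartAt 𝓘(ℝ, E) x x) :=
  (((contDiffAt_comp_extChartAt_symm hf).fderiv_right (m := 1) le_rfl).differentiableAt
    one_ne_zero).clm_apply (differentiableAt_chartField hW)

lemma mdifferentiableAt_fieldDeriv (hf : ContMDiffAt 𝓘(ℝ, E) 𝓘(ℝ, F) 2 f x)
    (hW : MDiffAt (T% W) x) :
    MDifferentiableAt 𝓘(ℝ, E) 𝓘(ℝ, F) (fieldDeriv f W) x := by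
  have h := (differentiableAt_fderiv_chartField hf hW).congr_of_eventuallyEq
    (fderiv_chartField_eventuallyEq W hf).symm
  refine (h.mdifferentiableAt.comp x
    (mdifferentiableAt_extChartAt (mem_chart_source E x))).congr_of_eventuallyEq ?_
  filter_upwards [extChartAt_source_mem_nhds (I := 𝓘(ℝ, E)) x] with y hy
  exact congrArg (fieldDeriv f W) ((extChartAt 𝓘(ℝ, E) x).left_inv hy).symm

lemma chartField_mlieBracket
    (hV : MDiffAt (T% V) x)
    (hW : MDiffAt (T% W) x) :
    chartField (mlieBracket 𝓘(ℝ, E) V W) x (extChartAt 𝓘(ℝ, E) x x) =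
      lieBracket ℝ (chartField V x) (chartField W x) (extChartAt 𝓘(ℝ, E) x x) := by
  have : IsManifold 𝓘(ℝ, E) (minSmoothness ℝ 2) M := by
    rwa [minSmoothness_of_isRCLikeNormedField]
  rw [chartField, mpullback_mlieBracket (by rwa [extChartAt_to_inv])
    (by rwa [extChartAt_to_inv]) (contMDiffAt_extChartAt_symm (mem_extChartAt_target x))
    (by simp), ← mlieBracketWithin_univ, mlieBracketWithin_eq_lieBracketWithin]
  exact congrFun lieBracketWithin_univ _

theorem fieldDeriv_mlieBracket (hf : ContMDiffAt 𝓘(ℝ, E) 𝓘(ℝ, F) 2 f x)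
    (hV : MDiffAt (T% V) x)
    (hW : MDiffAt (T% W) x) :
    fieldDeriv f (mlieBracket 𝓘(ℝ, E) V W) x =
      fieldDeriv (fieldDeriv f W) V x - fieldDeriv (fieldDeriv f V) W x := by
  have first_order {g : M → F} (hg : MDifferentiableAt 𝓘(ℝ, E) 𝓘(ℝ, F) g x)
      (X : Π x : M, TangentSpace 𝓘(ℝ, E) x) :
      fieldDeriv g X x = fderiv ℝ (g ∘ (extChartAt 𝓘(ℝ, E) x).symm) (extChartAt 𝓘(ℝ, E) x x)
        (chartField X x (extChartAt 𝓘(ℝ, E) x x)) := by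
    rw [fderiv_chartField X (mem_extChartAt_target x) (by rwa [extChartAt_to_inv]),
      extChartAt_to_inv]
  rw [first_order (hf.mdifferentiableAt two_ne_zero), chartField_mlieBracket hV hW,
    fderiv_apply_lieBracket (contDiffAt_comp_extChartAt_symm hf) (by simp)
      (differentiableAt_chartField hW) (differentiableAt_chartField hV),
    (fderiv_chartField_eventuallyEq W hf).fderiv_eq,
    (fderiv_chartField_eventuallyEq V hf).fderiv_eq,
    first_order (mdifferentiableAt_fieldDeriv hf hW),
    first_order (mdifferentiableAt_fieldDeriv hf hV)]

end VectorFields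

section RelatedVectorFields

open VectorField Filter Topology

variable {E : Type*} [NormedAddCommGroup E] [NormedSpace ℝ E]
  {M : Type*} [TopologicalSpace M] [ChartedSpace E M]
  {E' : Type*} [NormedAddCommGroup E'] [NormedSpace ℝ E']
  {M' : Type*} [TopologicalSpace M'] [ChartedSpace E' M']
  {F : Type*} [NormedAddCommGroup F] [NormedSpace ℝ F]
  {f : M → M'} {x : M} {V W : Π x : M, TangentSpace 𝓘(ℝ, E) x}
  {V' W' : Π y : M', TangentSpace 𝓘(ℝ, E') y}

lemma fieldDeriv_comp_of_related {g : M' → F} (hg : MDifferentiableAt 𝓘(ℝ, E') 𝓘(ℝ, F) g (f x))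
    (hf : MDifferentiableAt 𝓘(ℝ, E) 𝓘(ℝ, E') f x)
    (h : mfderiv 𝓘(ℝ, E) 𝓘(ℝ, E') f x (V x) = V' (f x)) :
    fieldDeriv (g ∘ f) V x = fieldDeriv g V' (f x) := by
  rw [fieldDeriv, mfderiv_comp x hg hf]
  exact congrArg (mfderiv 𝓘(ℝ, E') 𝓘(ℝ, F) g (f x)) h

lemma fieldDeriv_congr {g g' : M → F} (h : g =ᶠ[𝓝 x] g') :
    fieldDeriv g V x = fieldDeriv g' V x :=
  DFunLike.congr_fun h.mfderiv_eq (V x)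

variable [IsManifold 𝓘(ℝ, E) 2 M] [IsManifold 𝓘(ℝ, E') 2 M'] [CompleteSpace E] [CompleteSpace E']

/- Both sides are compared after differentiating the chart at `f x` along them. -/
theorem mfderiv_mlieBracket_of_related (hf : ContMDiffAt 𝓘(ℝ, E) 𝓘(ℝ, E') 2 f x)
    (hV : MDiffAt (T% V) x) (hW : MDiffAt (T% W) x)
    (hV' : MDiffAt (T% V') (f x)) (hW' : MDiffAt (T% W') (f x))
    (hVV' : ∀ᶠ y in 𝓝 x, mfderiv 𝓘(ℝ, E) 𝓘(ℝ, E') f y (V y) = V' (f y))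
    (hWW' : ∀ᶠ y in 𝓝 x, mfderiv 𝓘(ℝ, E) 𝓘(ℝ, E') f y (W y) = W' (f y)) :
    mfderiv 𝓘(ℝ, E) 𝓘(ℝ, E') f x (mlieBracket 𝓘(ℝ, E) V W x) =
      mlieBracket 𝓘(ℝ, E') V' W' (f x) := by
  have : IsManifold 𝓘(ℝ, E') 1 M' := .of_le one_le_two
  let φ : M' → E' := ⇑(extChartAt 𝓘(ℝ, E') (f x))
  have hφ : ContMDiffAt 𝓘(ℝ, E') 𝓘(ℝ, E') 2 φ (f x) := contMDiffAt_extChartAt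
  have hfd := hf.mdifferentiableAt two_ne_zero
  have hφd := hφ.mdifferentiableAt two_ne_zero
  have first_order {X : Π x : M, TangentSpace 𝓘(ℝ, E) x} {X' : Π y : M', TangentSpace 𝓘(ℝ, E') y}
      (h : ∀ᶠ y in 𝓝 x, mfderiv 𝓘(ℝ, E) 𝓘(ℝ, E') f y (X y) = X' (f y)) :
      fieldDeriv (φ ∘ f) X =ᶠ[𝓝 x] fieldDeriv φ X' ∘ f := by
    filter_upwards [h, (contMDiffAt_iff_contMDiffAt_nhds (by simp)).1 hf,
      hf.continuousAt ((contMDiffAt_iff_contMDiffAt_nhds (by simp)).1 hφ)] with y hy hfy hφy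
    exact fieldDeriv_comp_of_related (ContMDiffAt.mdifferentiableAt hφy two_ne_zero)
      (hfy.mdifferentiableAt two_ne_zero) hy
  have second_order {X Y : Π x : M, TangentSpace 𝓘(ℝ, E) x}
      {X' Y' : Π y : M', TangentSpace 𝓘(ℝ, E') y} (hY' : MDiffAt (T% Y') (f x))
      (hX : ∀ᶠ y in 𝓝 x, mfderiv 𝓘(ℝ, E) 𝓘(ℝ, E') f y (X y) = X' (f y))
      (hY : ∀ᶠ y in 𝓝 x, mfderiv 𝓘(ℝ, E) 𝓘(ℝ, E') f y (Y y) = Y' (f y)) :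
      fieldDeriv (fieldDeriv (φ ∘ f) Y) X x = fieldDeriv (fieldDeriv φ Y') X' (f x) :=
    (fieldDeriv_congr (first_order hY)).trans <|
      fieldDeriv_comp_of_related (mdifferentiableAt_fieldDeriv hφ hY') hfd hX.self_of_nhds
  have h := fieldDeriv_mlieBracket (hφ.comp x hf) hV hW
  rw [second_order hW' hVV' hWW', second_order hV' hWW' hVV',
    ← fieldDeriv_mlieBracket hφ hV' hW', fieldDeriv, mfderiv_comp x hφd hfd] at h
  exact (isInvertible_mfderiv_extChartAt (mem_extChartAt_source (f x))).injective h

end RelatedVectorFields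

section TangentDerivative

variable {E : Type*} [NormedAddCommGroup E] [NormedSpace ℝ E]
  {M : Type*} [TopologicalSpace M] [ChartedSpace E M]
  {E' : Type*} [NormedAddCommGroup E'] [NormedSpace ℝ E']
  {M' : Type*} [TopologicalSpace M'] [ChartedSpace E' M']
  {E'' : Type*} [NormedAddCommGroup E''] [NormedSpace ℝ E'']
  {M'' : Type*} [TopologicalSpace M''] [ChartedSpace E'' M'']

variable (E E') in
/-- The derivative of a map between manifolds, as a map between the model spaces. Unlike that of
`mfderiv`, its type does not depend on the base point, which may therefore be rewritten. -/
def modelDeriv (f : M → M') (x : M) : E →L[ℝ] E' := mfderiv 𝓘(ℝ, E) 𝓘(ℝ, E') f x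

lemma modelDeriv_comp {g : M' → M''} {f : M → M'} {x : M}
    (hg : MDifferentiableAt 𝓘(ℝ, E') 𝓘(ℝ, E'') g (f x))
    (hf : MDifferentiableAt 𝓘(ℝ, E) 𝓘(ℝ, E') f x) :
    modelDeriv E E'' (fun y ↦ g (f y)) x = modelDeriv E' E'' g (f x) ∘L modelDeriv E E' f x :=
  mfderiv_comp x hg hf

lemma modelDeriv_id (x : M) : modelDeriv E E (fun y : M ↦ y) x = .id ℝ E :=
  mfderiv_id

variable [h : RiemannianBundle (fun x : M ↦ TangentSpace 𝓘(ℝ, E) x)]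

/-- The Riemannian metric at `x`, as a bilinear form on the model space. As for `modelDeriv`, the
base point may be rewritten. -/
def metricAt (x : M) : E →L[ℝ] E →L[ℝ] ℝ := h.g.inner x

lemma metricAt_comm (x : M) (v w : E) : metricAt x v w = metricAt x w v := h.g.symm x v w

lemma metricAt_pos (x : M) (v : E) (hv : v ≠ 0) : 0 < metricAt x v v := h.g.pos x v hv

variable [RiemannianBundle (fun x : M' ↦ TangentSpace 𝓘(ℝ, E') x)]
  [RiemannianBundle (fun x : M'' ↦ TangentSpace 𝓘(ℝ, E'') x)]

namespace IsIsometricImmersion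

lemma mdifferentiable {f : M → M'} (hf : IsIsometricImmersion (E := E) (E' := E') f) :
    MDifferentiable 𝓘(ℝ, E) 𝓘(ℝ, E') f :=
  hf.1.mdifferentiable (by simp)

lemma metricAt_eq {f : M → M'} (hf : IsIsometricImmersion (E := E) (E' := E') f) (x : M)
    (v w : E) :
    metricAt (f x) (modelDeriv E E' f x v) (modelDeriv E E' f x w) = metricAt x v w :=
  hf.2 x v w

lemma comp {g : M' → M''} {f : M → M'} (hg : IsIsometricImmersion (E := E') (E' := E'') g)
    (hf : IsIsometricImmersion (E := E) (E' := E') f) :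
    IsIsometricImmersion (E := E) (E' := E'') (fun x ↦ g (f x)) :=
  ⟨hg.1.comp hf.1, fun x v w ↦ by
    change metricAt (E := E'') _ (modelDeriv E E'' (fun x ↦ g (f x)) x v)
      (modelDeriv E E'' (fun x ↦ g (f x)) x w) = metricAt (E := E) x v w
    rw [modelDeriv_comp (hg.mdifferentiable _) (hf.mdifferentiable _)]
    exact (hg.metricAt_eq _ _ _).trans (hf.metricAt_eq x v w)⟩

end IsIsometricImmersion

end TangentDerivative

section LeftInvariantVectorFields

open VectorField

variable {E : Type*} [NormedAddCommGroup E] [NormedSpace ℝ E]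
  {S : Type*} [TopologicalSpace S] [ChartedSpace E S] [Group S]

lemma mulInvariantVectorField_one (v : GroupLieAlgebra 𝓘(ℝ, E) S) :
    mulInvariantVectorField v (1 : S) = v := by
  change modelDeriv E E (fun x : S ↦ 1 * x) 1 v = v
  simp only [one_mul, modelDeriv_id]
  rfl

variable [LieGroup 𝓘(ℝ, E) ∞ S]

lemma mulInvariantVectorField_surjective (g : S) (w : TangentSpace 𝓘(ℝ, E) g) :
    ∃ v : GroupLieAlgebra 𝓘(ℝ, E) S, mulInvariantVectorField v g = w := by
  have h := modelDeriv_comp (f := fun x ↦ g⁻¹ * x) (x := g)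
    (mdifferentiable_mul_left (I := 𝓘(ℝ, E)) (a := g) _) (mdifferentiable_mul_left _)
  simp only [mul_inv_cancel_left, modelDeriv_id, inv_mul_cancel] at h
  exact ⟨_, (DFunLike.congr_fun h w).symm⟩

variable {E' : Type*} [NormedAddCommGroup E'] [NormedSpace ℝ E']
  {M : Type*} [TopologicalSpace M] [ChartedSpace E' M]

lemma modelDeriv_mulInvariantVectorField {f : S → M} {Φ : M → M} {g : S}
    (hf : MDifferentiable 𝓘(ℝ, E) 𝓘(ℝ, E') f) (hΦ : MDifferentiable 𝓘(ℝ, E') 𝓘(ℝ, E') Φ)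
    (h : ∀ x, f (g * x) = Φ (f x)) (v : GroupLieAlgebra 𝓘(ℝ, E) S) :
    modelDeriv E E' f g (mulInvariantVectorField v g) =
      modelDeriv E' E' Φ (f 1) (modelDeriv E E' f 1 v) := by
  have h_left := modelDeriv_comp (x := 1) (hf _) (mdifferentiable_mul_left (a := g) 1)
  have h_right := modelDeriv_comp (x := 1) (hΦ _) (hf _)
  simp only [h] at h_left
  rw [h_left, mul_one] at h_right
  exact DFunLike.congr_fun h_right v

lemma metricAt_mulInvariantVectorField [RiemannianBundle (fun x : M ↦ TangentSpace 𝓘(ℝ, E') x)]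
    {f : S → M} {Φ : M → M} {g : S} (hf : MDifferentiable 𝓘(ℝ, E) 𝓘(ℝ, E') f)
    (hΦ : IsIsometricImmersion (E := E') (E' := E') Φ) (h : ∀ x, f (g * x) = Φ (f x))
    (v w : GroupLieAlgebra 𝓘(ℝ, E) S) :
    metricAt (f g) (modelDeriv E E' f g (mulInvariantVectorField v g))
        (modelDeriv E E' f g (mulInvariantVectorField w g)) =
      metricAt (f 1) (modelDeriv E E' f 1 v) (modelDeriv E E' f 1 w) := by
  rw [modelDeriv_mulInvariantVectorField hf hΦ.mdifferentiable h,
    modelDeriv_mulInvariantVectorField hf hΦ.mdifferentiable h,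
    show f g = Φ (f 1) by rw [← h, mul_one]]
  exact hΦ.metricAt_eq _ _ _

end LeftInvariantVectorFields

section LieGroupHomomorphism

open VectorField Filter

variable {E : Type*} [NormedAddCommGroup E] [NormedSpace ℝ E]
  {S : Type*} [TopologicalSpace S] [ChartedSpace E S] [Group S] [LieGroup 𝓘(ℝ, E) ∞ S]
  {E' : Type*} [NormedAddCommGroup E'] [NormedSpace ℝ E']
  {G : Type*} [TopologicalSpace G] [ChartedSpace E' G] [Group G] [LieGroup 𝓘(ℝ, E') ∞ G]
  {ι : S →* G}

lemma mfderiv_mulInvariantVectorField_eq_lieMap (hι : ContMDiff 𝓘(ℝ, E) 𝓘(ℝ, E') ∞ ι)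
    (v : GroupLieAlgebra 𝓘(ℝ, E) S) (s : S) :
    mfderiv 𝓘(ℝ, E) 𝓘(ℝ, E') ι s (mulInvariantVectorField v s) =
      mulInvariantVectorField (lieMap (E := E) (E' := E') ι v) (ι s) := by
  refine (modelDeriv_mulInvariantVectorField (hι.mdifferentiable (by simp))
    mdifferentiable_mul_left (fun x ↦ map_mul ι s x) v).trans ?_
  rw [map_one]
  rfl

variable [FiniteDimensional ℝ E] [FiniteDimensional ℝ E']

theorem lieMap_lie (hι : ContMDiff 𝓘(ℝ, E) 𝓘(ℝ, E') ∞ ι) (v w : GroupLieAlgebra 𝓘(ℝ, E) S) :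
    lieMap (E := E) (E' := E') ι ⁅v, w⁆ =
      ⁅lieMap (E := E) (E' := E') ι v, lieMap (E := E) (E' := E') ι w⁆ := by
  have : IsManifold 𝓘(ℝ, E) 2 S := .of_le (n := ∞) ENat.LEInfty.out
  have : IsManifold 𝓘(ℝ, E') 2 G := .of_le (n := ∞) ENat.LEInfty.out
  have hrel (v : GroupLieAlgebra 𝓘(ℝ, E) S) := Eventually.of_forall (f := nhds 1)
    (mfderiv_mulInvariantVectorField_eq_lieMap hι v)
  have h := mfderiv_mlieBracket_of_related (hι.contMDiffAt.of_le ENat.LEInfty.out)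
    (mdifferentiableAt_mulInvariantVectorField v) (mdifferentiableAt_mulInvariantVectorField w)
    (mdifferentiableAt_mulInvariantVectorField _) (mdifferentiableAt_mulInvariantVectorField _)
    (hrel v) (hrel w)
  rw [GroupLieAlgebra.bracket_def, GroupLieAlgebra.bracket_def, ← map_one ι]
  exact h

/-- The differential of a smooth homomorphism, as a homomorphism of Lie algebras. -/
def lieMapHom (ι : S →* G) (hι : ContMDiff 𝓘(ℝ, E) 𝓘(ℝ, E') ∞ ι) :
    GroupLieAlgebra 𝓘(ℝ, E) S →ₗ⁅ℝ⁆ GroupLieAlgebra 𝓘(ℝ, E') G :=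
  { lieMap (E := E) (E' := E') ι with
    map_lie' := fun {v w} ↦ lieMap_lie hι v w }

end LieGroupHomomorphism

section LeftInvariantMetric

open VectorField

variable {E : Type*} [NormedAddCommGroup E] [NormedSpace ℝ E]
  {S : Type*} [TopologicalSpace S] [ChartedSpace E S] [Group S]
  [RiemannianBundle (fun x : S ↦ TangentSpace 𝓘(ℝ, E) x)]
  {E' : Type*} [NormedAddCommGroup E'] [NormedSpace ℝ E']

variable (E S) in
/-- The inner product on the Lie algebra of a Lie group with a Riemannian metric. -/
def lieMetric : LinearMap.BilinForm ℝ (GroupLieAlgebra 𝓘(ℝ, E) S) :=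
  LinearMap.mk₂ ℝ (fun v w : TangentSpace 𝓘(ℝ, E) (1 : S) ↦ inner ℝ v w)
    (fun _ _ _ ↦ inner_add_left _ _ _) (fun _ _ _ ↦ real_inner_smul_left _ _ _)
    (fun _ _ _ ↦ inner_add_right _ _ _) (fun _ _ _ ↦ real_inner_smul_right _ _ _)

lemma isInnerProduct_lieMetric : IsInnerProduct (lieMetric E S) where
  symm := metricAt_comm (E := E) (1 : S)
  pos := metricAt_pos (E := E) (1 : S)

lemma lieMetric_lieMap {G : Type*} [TopologicalSpace G] [ChartedSpace E' G] [Group G]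
    [RiemannianBundle (fun x : G ↦ TangentSpace 𝓘(ℝ, E') x)] {ι : S →* G}
    (hι : IsIsometricImmersion (E := E) (E' := E') ι) (v w : GroupLieAlgebra 𝓘(ℝ, E) S) :
    lieMetric E' G (lieMap (E := E) (E' := E') ι v) (lieMap (E := E) (E' := E') ι w) =
      lieMetric E S v w := by
  refine Eq.trans ?_ (hι.metricAt_eq (1 : S) v w)
  rw [map_one]
  rfl

variable (E S) in
/-- The Riemannian metric of the Lie group `S` is left-invariant. -/
def IsLeftInvariantMetric : Prop :=
  ∀ (g : S) (v w : GroupLieAlgebra 𝓘(ℝ, E) S),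
    inner ℝ (mulInvariantVectorField v g) (mulInvariantVectorField w g) = lieMetric E S v w

lemma IsLeftInvariantMetric.of_equivariant [LieGroup 𝓘(ℝ, E) ∞ S]
    {M : Type*} [TopologicalSpace M] [ChartedSpace E' M]
    [RiemannianBundle (fun x : M ↦ TangentSpace 𝓘(ℝ, E') x)]
    {f : S → M} (hf : IsIsometricImmersion (E := E) (E' := E') f) {Φ : S → M → M}
    (hΦ : ∀ g, IsIsometricImmersion (E := E') (E' := E') (Φ g))
    (h : ∀ g x, f (g * x) = Φ g (f x)) : IsLeftInvariantMetric E S := fun g v w ↦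
  (hf.metricAt_eq g _ _).symm.trans <|
    (metricAt_mulInvariantVectorField hf.mdifferentiable (hΦ g) (h g) v w).trans
      (hf.metricAt_eq 1 v w)

variable [FiniteDimensional ℝ E]

variable (E S) in
/-- The orthonormal basis of the Lie algebra in which `ricciOperator` is computed. -/
def lieBasis (i : Fin (Module.finrank ℝ (TangentSpace 𝓘(ℝ, E) (1 : S)))) :
    GroupLieAlgebra 𝓘(ℝ, E) S :=
  stdOrthonormalBasis ℝ (TangentSpace 𝓘(ℝ, E) (1 : S)) i

lemma isParsevalFrame_lieBasis : IsParsevalFrame (lieMetric E S) (lieBasis E S) := fun v ↦ by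
  refine Eq.trans (Finset.sum_congr rfl fun i _ ↦ ?_)
    ((stdOrthonormalBasis ℝ (TangentSpace 𝓘(ℝ, E) (1 : S))).sum_repr' v)
  rw [isInnerProduct_lieMetric.symm]
  rfl

variable [LieGroup 𝓘(ℝ, E) ∞ S]

/-- The left-invariant connection defined by `nabla`: the value at the identity of the covariant
derivative of left-invariant vector fields. -/
def leftCovariant (nabla : CovariantDerivative 𝓘(ℝ, E) E (TangentSpace 𝓘(ℝ, E) : S → Type _))
    (v w : GroupLieAlgebra 𝓘(ℝ, E) S) : GroupLieAlgebra 𝓘(ℝ, E) S :=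
  nabla (mulInvariantVectorField w) 1 v

namespace IsLeviCivita

variable {nabla : CovariantDerivative 𝓘(ℝ, E) E (TangentSpace 𝓘(ℝ, E) : S → Type _)}

lemma nabla_mulInvariantVectorField_sub (hn : IsLeviCivita nabla) (g : S)
    (v w : GroupLieAlgebra 𝓘(ℝ, E) S) :
    nabla (mulInvariantVectorField w) g (mulInvariantVectorField v g) -
      nabla (mulInvariantVectorField v) g (mulInvariantVectorField w g) =
      mulInvariantVectorField ⁅v, w⁆ g := by
  rw [(CovariantDerivative.torsion_eq_zero_iff nabla).1 hn.torsion_eq_zero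
    (mdifferentiableAt_mulInvariantVectorField v) (mdifferentiableAt_mulInvariantVectorField w),
    GroupLieAlgebra.bracket_def, mulInvariantVector_mlieBracket]

lemma inner_nabla_mulInvariantVectorField_add (hn : IsLeviCivita nabla)
    (hS : IsLeftInvariantMetric E S) (g : S) (u : TangentSpace 𝓘(ℝ, E) g)
    (v w : GroupLieAlgebra 𝓘(ℝ, E) S) :
    inner ℝ (nabla (mulInvariantVectorField v) g u) (mulInvariantVectorField w g) +
      inner ℝ (mulInvariantVectorField v g) (nabla (mulInvariantVectorField w) g u) = 0 := by
  rw [← hn.metric _ _ g u (mdifferentiableAt_mulInvariantVectorField v)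
    (mdifferentiableAt_mulInvariantVectorField w), funext fun y ↦ hS y v w, mfderiv_const]
  rfl

lemma isAlgebraicLeviCivita_of_mulInvariantVectorField_eq (hn : IsLeviCivita nabla)
    (hS : IsLeftInvariantMetric E S) (g : S)
    {U : GroupLieAlgebra 𝓘(ℝ, E) S → GroupLieAlgebra 𝓘(ℝ, E) S → GroupLieAlgebra 𝓘(ℝ, E) S}
    (hU : ∀ u v, mulInvariantVectorField (U u v) g =
      nabla (mulInvariantVectorField v) g (mulInvariantVectorField u g)) :
    IsAlgebraicLeviCivita (lieMetric E S) U where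
  torsion u v := isInnerProduct_lieMetric.ext fun w ↦ by
    rw [map_sub, LinearMap.sub_apply, ← hS g, ← hS g, ← hS g, hU, hU, ← inner_sub_left,
      hn.nabla_mulInvariantVectorField_sub]
  metric u v w := by
    rw [← hS g, ← hS g, hU, hU]
    exact hn.inner_nabla_mulInvariantVectorField_add hS g _ v w

theorem isAlgebraicLeviCivita_leftCovariant (hn : IsLeviCivita nabla)
    (hS : IsLeftInvariantMetric E S) :
    IsAlgebraicLeviCivita (lieMetric E S) (leftCovariant nabla) :=
  hn.isAlgebraicLeviCivita_of_mulInvariantVectorField_eq hS 1 fun u v ↦ by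
    simp only [mulInvariantVectorField_one]
    rfl

/- At every point the connection restricts to an algebraic Levi-Civita connection, and there is
only one. -/
theorem nabla_mulInvariantVectorField (hn : IsLeviCivita nabla)
    (hS : IsLeftInvariantMetric E S) (g : S) (u v : GroupLieAlgebra 𝓘(ℝ, E) S) :
    nabla (mulInvariantVectorField v) g (mulInvariantVectorField u g) =
      mulInvariantVectorField (leftCovariant nabla u v) g := by
  choose U hU using fun u v : GroupLieAlgebra 𝓘(ℝ, E) S ↦ mulInvariantVectorField_surjective g
    (nabla (mulInvariantVectorField v) g (mulInvariantVectorField u g))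
  rw [← hU, (hn.isAlgebraicLeviCivita_of_mulInvariantVectorField_eq hS g hU).unique
    isInnerProduct_lieMetric (hn.isAlgebraicLeviCivita_leftCovariant hS)]

lemma curvature_mulInvariantVectorField (hn : IsLeviCivita nabla)
    (hS : IsLeftInvariantMetric E S) (u v w : GroupLieAlgebra 𝓘(ℝ, E) S) :
    curvature nabla (mulInvariantVectorField u) (mulInvariantVectorField v)
      (mulInvariantVectorField w) (1 : S) = algebraicCurvature (leftCovariant nabla) u v w := by
  simp only [curvature, hn.nabla_mulInvariantVectorField hS, mulInvariantVectorField_one]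
  rw [← GroupLieAlgebra.bracket_def]
  rfl

theorem ricciOperator_eq (hn : IsLeviCivita nabla) (hS : IsLeftInvariantMetric E S)
    (v : GroupLieAlgebra 𝓘(ℝ, E) S) :
    ricciOperator nabla v = algebraicRicci (leftCovariant nabla) (lieBasis E S) v :=
  Finset.sum_congr rfl fun _ _ ↦ hn.curvature_mulInvariantVectorField hS _ _ _

end IsLeviCivita

end LeftInvariantMetric

section FieldDerivOfProducts

variable {E : Type*} [NormedAddCommGroup E] [NormedSpace ℝ E]
  {M : Type*} [TopologicalSpace M] [ChartedSpace E M]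
  {F : Type*} [NormedAddCommGroup F] [NormedSpace ℝ F]
  {F' : Type*} [NormedAddCommGroup F'] [NormedSpace ℝ F'] {x : M}

lemma fieldDeriv_comp_eq_zero {N : Type*} [TopologicalSpace N] [ChartedSpace F N] {g : N → F'}
    {f : M → N} {V : Π x : M, TangentSpace 𝓘(ℝ, E) x}
    (hg : MDifferentiableAt 𝓘(ℝ, F) 𝓘(ℝ, F') g (f x))
    (hf : MDifferentiableAt 𝓘(ℝ, E) 𝓘(ℝ, F) f x) (hV : modelDeriv E F f x (V x) = 0) :
    fieldDeriv (fun y ↦ g (f y)) V x = 0 :=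
  (fieldDeriv_comp_of_related (V' := 0) hg hf hV).trans (map_zero _)

lemma fieldDeriv_clm_apply {A : M → F →L[ℝ] F'} {u : M → F}
    (hA : MDifferentiableAt 𝓘(ℝ, E) 𝓘(ℝ, F →L[ℝ] F') A x)
    (hu : MDifferentiableAt 𝓘(ℝ, E) 𝓘(ℝ, F) u x) (V : Π x : M, TangentSpace 𝓘(ℝ, E) x) :
    fieldDeriv (fun y ↦ A y (u y)) V x = fieldDeriv A V x (u x) + A x (fieldDeriv u V x) := by
  have h : HasMFDerivAt 𝓘(ℝ, E) 𝓘(ℝ, F') (fun y ↦ A y (u y)) x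
      (A x ∘L modelDeriv E F u x + (modelDeriv E (F →L[ℝ] F') A x).flip (u x)) :=
    ⟨hA.continuousAt.clm_apply hu.continuousAt, by
      convert hA.hasMFDerivAt.2.clm_apply hu.hasMFDerivAt.2 using 1
      simp only [mfld_simps]
      rfl⟩
  exact (DFunLike.congr_fun h.mfderiv (V x)).trans (add_comm _ _)

lemma fieldDeriv_clm_apply_apply {F'' : Type*} [NormedAddCommGroup F''] [NormedSpace ℝ F'']
    {A : M → F →L[ℝ] F' →L[ℝ] F''} {u : M → F} {w : M → F'}
    (hA : MDifferentiableAt 𝓘(ℝ, E) 𝓘(ℝ, F →L[ℝ] F' →L[ℝ] F'') A x)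
    (hu : MDifferentiableAt 𝓘(ℝ, E) 𝓘(ℝ, F) u x) (hw : MDifferentiableAt 𝓘(ℝ, E) 𝓘(ℝ, F') w x)
    (V : Π x : M, TangentSpace 𝓘(ℝ, E) x) :
    fieldDeriv (fun y ↦ A y (u y) (w y)) V x = fieldDeriv A V x (u x) (w x) +
      A x (fieldDeriv u V x) (w x) + A x (u x) (fieldDeriv w V x) := by
  rw [fieldDeriv_clm_apply (A := fun y ↦ A y (u y)) (hA.clm_apply hu) hw,
    fieldDeriv_clm_apply hA hu]
  rfl

lemma mdifferentiableAt_clm_of_apply [FiniteDimensional ℝ F] {A : M → F →L[ℝ] F'}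
    (hA : ∀ u, MDifferentiableAt 𝓘(ℝ, E) 𝓘(ℝ, F') (fun y ↦ A y u) x) :
    MDifferentiableAt 𝓘(ℝ, E) 𝓘(ℝ, F →L[ℝ] F') A x := by
  let b := Module.finBasis ℝ F
  have h_sum : A = ∑ i, fun y ↦
      ContinuousLinearMap.smulRightL ℝ F F' (b.coord i).toContinuousLinearMap (A y (b i)) := by
    ext y u
    conv_lhs => rw [← b.sum_repr u]
    simp [-Module.Basis.sum_repr]
  rw [h_sum]
  exact MDifferentiableAt.sum fun i _ ↦
    (ContinuousLinearMap.mdifferentiableAt _).comp x (hA (b i))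

end FieldDerivOfProducts

section ChartMetric

open VectorField

variable {E : Type*} [NormedAddCommGroup E] [NormedSpace ℝ E]
  {M : Type*} [TopologicalSpace M] [ChartedSpace E M]
  [RiemannianBundle (fun x : M ↦ TangentSpace 𝓘(ℝ, E) x)]

/-- The Riemannian metric at `y` in the coordinates of the chart at `x`. It is meaningful only for
`y` in the domain of that chart. -/
def chartMetric (x y : M) : E →L[ℝ] E →L[ℝ] ℝ :=
  (metricAt y).bilinearComp (modelDeriv E E (extChartAt 𝓘(ℝ, E) x) y).inverse
    (modelDeriv E E (extChartAt 𝓘(ℝ, E) x) y).inverse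

lemma chartMetric_modelDeriv_comp [IsManifold 𝓘(ℝ, E) 1 M]
    {E' : Type*} [NormedAddCommGroup E'] [NormedSpace ℝ E']
    {N : Type*} [TopologicalSpace N] [ChartedSpace E' N] {p : N → M} {x : M} {y : N}
    (hp : MDifferentiableAt 𝓘(ℝ, E') 𝓘(ℝ, E) p y)
    (hy : p y ∈ (extChartAt 𝓘(ℝ, E) x).source) (v w : E') :
    chartMetric x (p y) (modelDeriv E' E (fun y ↦ extChartAt 𝓘(ℝ, E) x (p y)) y v)
        (modelDeriv E' E (fun y ↦ extChartAt 𝓘(ℝ, E) x (p y)) y w) =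
      metricAt (p y) (modelDeriv E' E p y v) (modelDeriv E' E p y w) := by
  have h_inv := (isInvertible_mfderiv_extChartAt hy).inverse_apply_self
  rw [modelDeriv_comp (mdifferentiableAt_extChartAt (by simpa using hy)) hp]
  exact congrArg₂ (fun v w : E ↦ metricAt (p y) v w) (h_inv _) (h_inv _)

variable [FiniteDimensional ℝ E] [IsManifold 𝓘(ℝ, E) ∞ M]
  [IsContMDiffRiemannianBundle 𝓘(ℝ, E) ∞ E (fun x : M ↦ TangentSpace 𝓘(ℝ, E) x)]

lemma mdifferentiableAt_chartMetric (x : M) :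
    MDifferentiableAt 𝓘(ℝ, E) 𝓘(ℝ, E →L[ℝ] E →L[ℝ] ℝ) (chartMetric (E := E) x) x := by
  have : IsManifold 𝓘(ℝ, E) 2 M := .of_le (n := ∞) ENat.LEInfty.out
  have : IsManifold 𝓘(ℝ, E) 1 M := .of_le (n := 2) one_le_two
  let frame (e : E) : Π y : M, TangentSpace 𝓘(ℝ, E) y :=
    mpullback 𝓘(ℝ, E) 𝓘(ℝ, E) (extChartAt 𝓘(ℝ, E) x) (fun _ ↦ e)
  have h_frame (e : E) : MDiffAt (T% (frame e)) x :=
    MDifferentiableAt.mpullback_vectorField (n := 2)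
      ((contMDiffAt_vectorSpace_iff_contDiffAt.2 contDiffAt_const).mdifferentiableAt one_ne_zero)
      contMDiffAt_extChartAt (isInvertible_mfderiv_extChartAt (mem_extChartAt_source x)) le_rfl
  refine mdifferentiableAt_clm_of_apply fun u ↦ mdifferentiableAt_clm_of_apply fun w ↦ ?_
  exact MDifferentiableAt.inner_bundle (E := fun x : M ↦ TangentSpace 𝓘(ℝ, E) x) (b := fun x ↦ x)
    (v := frame u) (w := frame w) (h_frame u) (h_frame w)

end ChartMetric

section VerticalInvariance

open VectorField Filter Topology

variable {E : Type*} [NormedAddCommGroup E] [NormedSpace ℝ E] [FiniteDimensional ℝ E]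
  {G : Type*} [TopologicalSpace G] [ChartedSpace E G] [Group G] [LieGroup 𝓘(ℝ, E) ∞ G]
  {F : Type*} [NormedAddCommGroup F] [NormedSpace ℝ F]

lemma fieldDeriv_fieldDeriv_of_vertical {f : G → F}
    (hf : ContMDiffAt 𝓘(ℝ, E) 𝓘(ℝ, F) 2 f 1) {z : GroupLieAlgebra 𝓘(ℝ, E) G}
    (hz : fieldDeriv f (mulInvariantVectorField z) =ᶠ[𝓝 1] 0) (v : GroupLieAlgebra 𝓘(ℝ, E) G) :
    fieldDeriv (fieldDeriv f (mulInvariantVectorField v)) (mulInvariantVectorField z) 1 =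
      modelDeriv E F f 1 (⁅z, v⁆ : GroupLieAlgebra 𝓘(ℝ, E) G) := by
  have : IsManifold 𝓘(ℝ, E) 2 G := .of_le (n := ∞) ENat.LEInfty.out
  have h_bracket := fieldDeriv_mlieBracket hf (mdifferentiableAt_mulInvariantVectorField z)
    (mdifferentiableAt_mulInvariantVectorField v)
  have h_zero : fieldDeriv (fieldDeriv f (mulInvariantVectorField z)) (mulInvariantVectorField v)
      (1 : G) = 0 :=
    (fieldDeriv_congr hz).trans (DFunLike.congr_fun mfderiv_const _)
  rw [h_zero, sub_zero] at h_bracket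
  exact h_bracket.symm

/- The left-hand side is the derivative of the constant `c` along `z`. -/
lemma apply_lie_add_apply_lie_of_vertical {A : G → F →L[ℝ] F →L[ℝ] ℝ} {f : G → F} {c : ℝ}
    {z v w : GroupLieAlgebra 𝓘(ℝ, E) G}
    (hA : MDifferentiableAt 𝓘(ℝ, E) 𝓘(ℝ, F →L[ℝ] F →L[ℝ] ℝ) A 1)
    (hf : ContMDiffAt 𝓘(ℝ, E) 𝓘(ℝ, F) 2 f 1)
    (hAz : fieldDeriv A (mulInvariantVectorField z) 1 = 0)
    (hfz : fieldDeriv f (mulInvariantVectorField z) =ᶠ[𝓝 1] 0)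
    (h_const : ∀ᶠ g in 𝓝 1, A g (fieldDeriv f (mulInvariantVectorField v) g)
      (fieldDeriv f (mulInvariantVectorField w) g) = c) :
    A 1 (modelDeriv E F f 1 (⁅z, v⁆ : GroupLieAlgebra 𝓘(ℝ, E) G)) (modelDeriv E F f 1 w) +
      A 1 (modelDeriv E F f 1 v) (modelDeriv E F f 1 (⁅z, w⁆ : GroupLieAlgebra 𝓘(ℝ, E) G)) =
        0 := by
  have : IsManifold 𝓘(ℝ, E) 2 G := .of_le (n := ∞) ENat.LEInfty.out
  have hX (v) := mdifferentiableAt_fieldDeriv hf (mdifferentiableAt_mulInvariantVectorField v)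
  have hX_one (v) : fieldDeriv f (mulInvariantVectorField v) 1 = modelDeriv E F f 1 v :=
    congrArg (modelDeriv E F f 1) (mulInvariantVectorField_one v)
  have h := (fieldDeriv_congr h_const).trans
    (DFunLike.congr_fun mfderiv_const (mulInvariantVectorField z 1))
  rw [fieldDeriv_clm_apply_apply hA (hX v) (hX w), hAz,
    fieldDeriv_fieldDeriv_of_vertical hf hfz, fieldDeriv_fieldDeriv_of_vertical hf hfz,
    hX_one, hX_one] at h
  exact (congrArg (· + _) (zero_add _).symm).trans h

variable [FiniteDimensional ℝ F]
  {M : Type*} [TopologicalSpace M] [ChartedSpace F M] [IsManifold 𝓘(ℝ, F) ∞ M]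
  [RiemannianBundle (fun x : M ↦ TangentSpace 𝓘(ℝ, F) x)]
  [IsContMDiffRiemannianBundle 𝓘(ℝ, F) ∞ F (fun x : M ↦ TangentSpace 𝓘(ℝ, F) x)]

/- In a chart of `M`, the coefficients of the metric along `p` are constant along the vertical
field `z`. -/
theorem metricAt_lie_add_metricAt_lie {p : G → M} (hp : ContMDiff 𝓘(ℝ, E) 𝓘(ℝ, F) ∞ p)
    (hinv : ∀ (g : G) (v w : GroupLieAlgebra 𝓘(ℝ, E) G),
      metricAt (p g) (modelDeriv E F p g (mulInvariantVectorField v g))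
        (modelDeriv E F p g (mulInvariantVectorField w g)) =
      metricAt (p 1) (modelDeriv E F p 1 v) (modelDeriv E F p 1 w))
    {z : GroupLieAlgebra 𝓘(ℝ, E) G}
    (hz : ∀ g, modelDeriv E F p g (mulInvariantVectorField z g) = 0)
    (v w : GroupLieAlgebra 𝓘(ℝ, E) G) :
    metricAt (p 1) (modelDeriv E F p 1 (⁅z, v⁆ : GroupLieAlgebra 𝓘(ℝ, E) G))
        (modelDeriv E F p 1 w) +
      metricAt (p 1) (modelDeriv E F p 1 v)
        (modelDeriv E F p 1 (⁅z, w⁆ : GroupLieAlgebra 𝓘(ℝ, E) G)) = 0 := by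
  have : IsManifold 𝓘(ℝ, F) 2 M := .of_le (n := ∞) ENat.LEInfty.out
  have : IsManifold 𝓘(ℝ, F) 1 M := .of_le (n := 2) one_le_two
  have hpd := hp.mdifferentiable (by simp)
  have h_source : ∀ᶠ g in 𝓝 1, p g ∈ (extChartAt 𝓘(ℝ, F) (p 1)).source :=
    hp.continuous.continuousAt (extChartAt_source_mem_nhds (p 1))
  have h_metric := mdifferentiableAt_chartMetric (E := F) (p 1)
  have h_chart : fieldDeriv (fun g ↦ extChartAt 𝓘(ℝ, F) (p 1) (p g)) (mulInvariantVectorField z)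
      =ᶠ[𝓝 1] 0 := by
    filter_upwards [h_source] with g hg
    exact fieldDeriv_comp_eq_zero (mdifferentiableAt_extChartAt (by simpa using hg)) (hpd g) (hz g)
  have h_const : ∀ᶠ g in 𝓝 1, chartMetric (E := F) (p 1) (p g)
      (fieldDeriv (fun g ↦ extChartAt 𝓘(ℝ, F) (p 1) (p g)) (mulInvariantVectorField v) g)
      (fieldDeriv (fun g ↦ extChartAt 𝓘(ℝ, F) (p 1) (p g)) (mulInvariantVectorField w) g) =
        metricAt (p 1) (modelDeriv E F p 1 v) (modelDeriv E F p 1 w) := by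
    filter_upwards [h_source] with g hg
    exact (chartMetric_modelDeriv_comp (hpd g) hg _ _).trans (hinv g v w)
  have h_one := chartMetric_modelDeriv_comp (hpd 1) (mem_extChartAt_source (p 1))
  exact (congrArg₂ (· + ·) (h_one _ _) (h_one _ _)).symm.trans <|
    apply_lie_add_apply_lie_of_vertical (A := fun g ↦ chartMetric (E := F) (p 1) (p g))
      (h_metric.comp 1 (hpd 1))
      (contMDiffAt_extChartAt.comp 1 (hp.contMDiffAt.of_le ENat.LEInfty.out))
      (fieldDeriv_comp_eq_zero h_metric (hpd 1) (hz 1)) h_chart h_const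

end VerticalInvariance

section OrbitForm

open VectorField

variable {E : Type*} [NormedAddCommGroup E] [NormedSpace ℝ E]
  {G : Type*} [TopologicalSpace G] [ChartedSpace E G] [Group G]
  {F : Type*} [NormedAddCommGroup F] [NormedSpace ℝ F]
  {M : Type*} [TopologicalSpace M] [ChartedSpace F M] [MulAction G M]
  [RiemannianBundle (fun x : M ↦ TangentSpace 𝓘(ℝ, F) x)]

variable (E G F) in
/-- The bilinear form on the Lie algebra of `G` obtained by pulling back the metric of `M` along
the orbit map of `o`. -/
def orbitForm (o : M) : LinearMap.BilinForm ℝ (GroupLieAlgebra 𝓘(ℝ, E) G) :=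
  LinearMap.mk₂ ℝ (fun v w : TangentSpace 𝓘(ℝ, E) (1 : G) ↦ orbitInner (F := F) o v w)
    (fun _ _ _ ↦ by simp only [orbitInner, map_add, inner_add_left])
    (fun _ _ _ ↦ by simp only [orbitInner, map_smul, real_inner_smul_left, smul_eq_mul])
    (fun _ _ _ ↦ by simp only [orbitInner, map_add, inner_add_right])
    (fun _ _ _ ↦ by simp only [orbitInner, map_smul, real_inner_smul_right, smul_eq_mul])

lemma lieMetric_eq_orbitForm {E' : Type*} [NormedAddCommGroup E'] [NormedSpace ℝ E']
    {S : Type*} [TopologicalSpace S] [ChartedSpace E' S] [Group S]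
    [RiemannianBundle (fun x : S ↦ TangentSpace 𝓘(ℝ, E') x)] {j : S →* G} {o : M}
    (ho : MDifferentiable 𝓘(ℝ, E) 𝓘(ℝ, F) (fun g : G ↦ g • o))
    (hj : MDifferentiable 𝓘(ℝ, E') 𝓘(ℝ, E) j)
    (hS : IsIsometricImmersion (E := E') (E' := F) (fun s : S ↦ j s • o))
    (v w : GroupLieAlgebra 𝓘(ℝ, E') S) :
    lieMetric E' S v w = orbitForm E G F o (lieMap (E := E') (E' := E) j v)
      (lieMap (E := E') (E' := E) j w) := by
  have h := hS.metricAt_eq 1 v w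
  rw [modelDeriv_comp (f := j) (g := fun g : G ↦ g • o) (ho _) (hj _), map_one] at h
  exact h.symm

theorem orbitForm_lie_add_orbitForm_lie [FiniteDimensional ℝ E] [LieGroup 𝓘(ℝ, E) ∞ G]
    [FiniteDimensional ℝ F] [IsManifold 𝓘(ℝ, F) ∞ M]
    [IsContMDiffRiemannianBundle 𝓘(ℝ, F) ∞ F (fun x : M ↦ TangentSpace 𝓘(ℝ, F) x)] {o : M}
    (ho : ContMDiff 𝓘(ℝ, E) 𝓘(ℝ, F) ∞ (fun g : G ↦ g • o))
    (hG : ∀ g : G, IsIsometricImmersion (E := F) (E' := F) (fun x : M ↦ g • x))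
    {Z : GroupLieAlgebra 𝓘(ℝ, E) G} (hZ : orbitMapDeriv (F := F) o Z = 0)
    (X Y : GroupLieAlgebra 𝓘(ℝ, E) G) :
    orbitForm E G F o ⁅Z, X⁆ Y + orbitForm E G F o X ⁅Z, Y⁆ = 0 := by
  have hod := ho.mdifferentiable (by simp)
  have h_equivariant (g x : G) : (g * x) • o = g • x • o := mul_smul g x o
  refine metricAt_lie_add_metricAt_lie ho
    (fun g ↦ metricAt_mulInvariantVectorField hod (hG g) (h_equivariant g)) (fun g ↦ ?_) X Y
  rw [modelDeriv_mulInvariantVectorField hod (hG g).mdifferentiable (h_equivariant g)]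
  exact (congrArg _ hZ).trans (map_zero _)

end OrbitForm

section SymmetricSpaceAlgebra

variable {E : Type*} [NormedAddCommGroup E] [NormedSpace ℝ E] [FiniteDimensional ℝ E]
  {G : Type*} [TopologicalSpace G] [ChartedSpace E G] [Group G] [LieGroup 𝓘(ℝ, E) ∞ G]
  {θ : GroupLieAlgebra 𝓘(ℝ, E) G →ₗ⁅ℝ⁆ GroupLieAlgebra 𝓘(ℝ, E) G}

lemma ker_kPart_eq_pSpace : LinearMap.ker (kPart θ) = pSpace θ :=
  Submodule.ext fun _ ↦ kPart_eq_zero_iff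

/- If `X` commutes with `𝔞`, then `𝔞 ⊕ ℝ X` is abelian. -/
theorem IsMaximalAbelian.isCartanSubspace {𝔞 : Submodule ℝ (GroupLieAlgebra 𝓘(ℝ, E) G)}
    (h𝔞 : IsMaximalAbelian θ 𝔞) : IsCartanSubspace θ 𝔞 where
  odd _ hA := h𝔞.le hA
  abelian := h𝔞.abelian
  centralizer X hX hcomm := by
    have h_abelian : ∀ Y ∈ 𝔞 ⊔ Submodule.span ℝ {X}, ∀ Z ∈ 𝔞 ⊔ Submodule.span ℝ {X},
        ⁅Y, Z⁆ = 0 := by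
      simp only [Submodule.mem_sup, Submodule.mem_span_singleton]
      rintro _ ⟨A, hA, _, ⟨s, rfl⟩, rfl⟩ _ ⟨B, hB, _, ⟨t, rfl⟩, rfl⟩
      have hXB : ⁅X, B⁆ = 0 := by rw [← lie_skew, hcomm B hB, neg_zero]
      simp only [add_lie, lie_add, smul_lie, lie_smul, h𝔞.abelian A hA B hB, hcomm A hA, hXB,
        lie_self, smul_zero, add_zero]
    rw [← h𝔞.maximal _
      (sup_le h𝔞.le ((Submodule.span_singleton_le_iff_mem _ _).2 hX)) h_abelian le_sup_left]
    exact Submodule.mem_sup_right (Submodule.mem_span_singleton_self X)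

variable {F : Type*} [NormedAddCommGroup F] [NormedSpace ℝ F]
  {M : Type*} [TopologicalSpace M] [ChartedSpace F M] [MulAction G M]
  [RiemannianBundle (fun x : M ↦ TangentSpace 𝓘(ℝ, F) x)] {o : M}

namespace IsIrreducibleSymmetricSpace

lemma contMDiff_orbitMap (hM : IsIrreducibleSymmetricSpace (F := F) o θ) :
    ContMDiff 𝓘(ℝ, E) 𝓘(ℝ, F) ∞ (fun g : G ↦ g • o) :=
  have := hM.smooth
  (contMDiff_id (I := 𝓘(ℝ, E)) (M := G)).smul contMDiff_const

lemma isLeftInvariantMetric (hM : IsIrreducibleSymmetricSpace (F := F) o θ)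
    {E' : Type*} [NormedAddCommGroup E'] [NormedSpace ℝ E']
    {S : Type*} [TopologicalSpace S] [ChartedSpace E' S] [Group S] [LieGroup 𝓘(ℝ, E') ∞ S]
    [RiemannianBundle (fun x : S ↦ TangentSpace 𝓘(ℝ, E') x)] {j : S →* G}
    (hS : IsIsometricImmersion (E := E') (E' := F) (fun s : S ↦ j s • o)) :
    IsLeftInvariantMetric E' S :=
  .of_equivariant hS (fun g ↦ hM.isometric (j g)) fun g x ↦ by rw [map_mul, mul_smul]

lemma isCartanInvolution (hM : IsIrreducibleSymmetricSpace (F := F) o θ) :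
    IsCartanInvolution θ where
  involutive := hM.involutive
  cartan := hM.cartan

lemma isIsotropyIrreducible (hM : IsIrreducibleSymmetricSpace (F := F) o θ) :
    IsIsotropyIrreducible θ where
  nontrivial := ker_kPart_eq_pSpace (θ := θ) ▸ hM.nontrivial
  irreducible W := ker_kPart_eq_pSpace (θ := θ) ▸ hM.irreducible W

theorem isInvariantMetric [FiniteDimensional ℝ F] [IsManifold 𝓘(ℝ, F) ∞ M]
    [IsContMDiffRiemannianBundle 𝓘(ℝ, F) ∞ F (fun x : M ↦ TangentSpace 𝓘(ℝ, F) x)]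
    (hM : IsIrreducibleSymmetricSpace (F := F) o θ) : IsInvariantMetric θ (orbitForm E G F o) where
  symm X Y := real_inner_comm (orbitMapDeriv (F := F) o Y) (orbitMapDeriv (F := F) o X)
  pos X hX := real_inner_self_pos.2 fun h ↦ hX ((hM.isotropy X).2 h)
  vertical X Y hX := by
    change inner ℝ (orbitMapDeriv (F := F) o X) (orbitMapDeriv (F := F) o Y) = 0
    rw [(hM.isotropy X).1 hX, inner_zero_left]
  invariant Z X Y hZ :=
    orbitForm_lie_add_orbitForm_lie hM.contMDiff_orbitMap hM.isometric ((hM.isotropy Z).1 hZ) X Y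

end IsIrreducibleSymmetricSpace

end SymmetricSpaceAlgebra

section Hypersurfaces

variable {L : Type*} [LieRing L] [LieAlgebra ℝ L] [FiniteDimensional ℝ L] {θ : L →ₗ⁅ℝ⁆ L}
  {Q : LinearMap.BilinForm ℝ L} {𝔟 : Type*} [LieRing 𝔟] [LieAlgebra ℝ 𝔟] {J : 𝔟 →ₗ⁅ℝ⁆ L}
  {q : LinearMap.BilinForm ℝ 𝔟} {U : 𝔟 → 𝔟 → 𝔟} {𝔰 : Type*} [LieRing 𝔰] [LieAlgebra ℝ 𝔰]
  [FiniteDimensional ℝ 𝔰] {q' : LinearMap.BilinForm ℝ 𝔰} {V : 𝔰 → 𝔰 → 𝔰} {f : 𝔰 →ₗ⁅ℝ⁆ 𝔟} {A : 𝔟}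
  {c : ℝ} {ι : Type*} [Fintype ι] {e : ι → 𝔰}

theorem IsSimplyTransitive.exists_lieDerivation_ricci (hJ : IsSimplyTransitive θ Q J q)
    (hQ : IsInvariantMetric θ Q) (hθ : IsCartanInvolution θ) (hc_ne : c ≠ 0)
    (hc : ∀ X Y, Q X Y = c * killingForm ℝ L (pPart θ X) Y) (hU : IsAlgebraicLeviCivita q U)
    (hV : IsAlgebraicLeviCivita q' V) (hA : IsUnitNormal q q' f A) (hA_odd : θ (J A) = -J A)
    (he : IsParsevalFrame q' e) :
    ∃ D : LieDerivation ℝ 𝔰 𝔰, (∀ x, f (D x) = ⁅A, f x⁆) ∧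
      ∀ v, algebraicRicci V e v =
        (-(2 * c)⁻¹) • v + LinearMap.trace ℝ 𝔰 D.toLinearMap • D v := by
  have hq := hJ.isInnerProduct
  have hUA := hJ.connection_eq_zero hQ hθ.involutive hU hA_odd
  obtain ⟨D, hD⟩ :=
    exists_lieDerivation_map_eq_lie hA.injective (hU.exists_map_eq_lie_normal hq hA hUA)
  exact ⟨D, hD, hU.algebraicRicci_of_einstein hV hq hA hUA (D := D.toLinearMap) hD he
    (hJ.algebraicRicci_eq hQ hθ hc_ne hc hU (hA.isParsevalFrame_normalFrame hq he))⟩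

end Hypersurfaces

end

theorem proposition4p4
    {EG : Type*} [NormedAddCommGroup EG] [NormedSpace ℝ EG] [FiniteDimensional ℝ EG]
    {G : Type*} [TopologicalSpace G] [ChartedSpace EG G] [Group G] [LieGroup 𝓘(ℝ, EG) ∞ G]
    {EM : Type*} [NormedAddCommGroup EM] [NormedSpace ℝ EM] [FiniteDimensional ℝ EM]
    {M : Type*} [TopologicalSpace M] [ChartedSpace EM M] [IsManifold 𝓘(ℝ, EM) ∞ M]
    [RiemannianBundle (fun x : M ↦ TangentSpace 𝓘(ℝ, EM) x)]
    [IsContMDiffRiemannianBundle 𝓘(ℝ, EM) ∞ EM (fun x : M ↦ TangentSpace 𝓘(ℝ, EM) x)]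
    [MulAction G M]
    -- `M` is an irreducible symmetric space of non-compact type, `M = G / K`, `o = eK`
    (o : M) (θ : GroupLieAlgebra 𝓘(ℝ, EG) G →ₗ⁅ℝ⁆ GroupLieAlgebra 𝓘(ℝ, EG) G)
    (hM : IsIrreducibleSymmetricSpace (F := EM) o θ)
    -- data of an Iwasawa decomposition of `𝔤`
    (𝔞 : Submodule ℝ (GroupLieAlgebra 𝓘(ℝ, EG) G)) (h𝔞 : IsMaximalAbelian θ 𝔞)
    (P : Set (Module.Dual ℝ 𝔞)) (hP : IsPositivity P)
    -- the connected Lie subgroup `AN` of `G` with Lie algebra `𝔞 ⊕ 𝔫`; its metric is pulled back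
    -- from `M`
    {EA : Type*} [NormedAddCommGroup EA] [NormedSpace ℝ EA] [FiniteDimensional ℝ EA]
    {AN : Type*} [TopologicalSpace AN] [ChartedSpace EA AN] [Group AN] [LieGroup 𝓘(ℝ, EA) ∞ AN]
    [RiemannianBundle (fun x : AN ↦ TangentSpace 𝓘(ℝ, EA) x)]
    (j : AN →* G) (hj : IsConnectedLieSubgroup (E := EA) (E' := EG) j (𝔞 ⊔ nilpotentPart 𝔞 P))
    (hAN : IsIsometricImmersion (E := EA) (E' := EM) (fun h : AN ↦ j h • o))
    (nablaAN : CovariantDerivative 𝓘(ℝ, EA) EA (TangentSpace 𝓘(ℝ, EA) : AN → Type _))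
    (hnablaAN : IsLeviCivita nablaAN)
    -- the unit vector `H ∈ 𝔞`
    (H : GroupLieAlgebra 𝓘(ℝ, EG) G) (hH : H ∈ 𝔞) (hH_unit : orbitInner (F := EM) o H H = 1)
    -- the connected Lie subgroup `S` of `AN` with Lie algebra `(𝔞 ⊖ ℝ H) ⊕ 𝔫`, with the metric
    -- induced from `AN`
    {ES : Type*} [NormedAddCommGroup ES] [NormedSpace ℝ ES] [FiniteDimensional ℝ ES]
    {S : Type*} [TopologicalSpace S] [ChartedSpace ES S] [Group S] [LieGroup 𝓘(ℝ, ES) ∞ S]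
    [RiemannianBundle (fun x : S ↦ TangentSpace 𝓘(ℝ, ES) x)]
    (ι : S →* AN)
    (hι : IsConnectedLieSubgroup (E := ES) (E' := EA) ι
      ((orthogonalIn (F := EM) o 𝔞 H ⊔ nilpotentPart 𝔞 P).comap (lieMap (E := EA) (E' := EG) j)))
    (hS : IsIsometricImmersion (E := ES) (E' := EA) ι)
    (nablaS : CovariantDerivative 𝓘(ℝ, ES) ES (TangentSpace 𝓘(ℝ, ES) : S → Type _))
    (hnablaS : IsLeviCivita nablaS) :
    IsSolvsoliton nablaS ∧
    ∃ k : ℝ, k < 0 ∧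
      -- `M ≅ AN` is Einstein with Einstein constant `k`
      (∀ v : GroupLieAlgebra 𝓘(ℝ, EA) AN, ricciOperator nablaAN v = k • v) ∧
      -- `Ric = k Id + tr(ad H) ad H` on the Lie algebra of `S`, on which `ad H` is a derivation
      ∃ adH : LieDerivation ℝ (GroupLieAlgebra 𝓘(ℝ, ES) S) (GroupLieAlgebra 𝓘(ℝ, ES) S),
        (∀ v : GroupLieAlgebra 𝓘(ℝ, ES) S,
          lieMap (E := EA) (E' := EG) j (lieMap (E := ES) (E' := EA) ι (adH v)) =
            ⁅H, lieMap (E := EA) (E' := EG) j (lieMap (E := ES) (E' := EA) ι v)⁆) ∧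
        ∀ v : GroupLieAlgebra 𝓘(ℝ, ES) S, ricciOperator nablaS v =
          k • v + LinearMap.trace ℝ (GroupLieAlgebra 𝓘(ℝ, ES) S) adH.toLinearMap • adH v := by
  have hθ := hM.isCartanInvolution
  have hQ := hM.isInvariantMetric
  obtain ⟨c, hc_pos, hc⟩ := hQ.exists_eq_killingForm hθ hM.isIsotropyIrreducible
  let J := lieMapHom j hj.contMDiff
  obtain ⟨A, rfl⟩ : ∃ A, J A = H := hj.range_lieMap.ge (Submodule.mem_sup_left hH)
  let f := lieMapHom ι hι.contMDiff
  have h_pullback := lieMetric_eq_orbitForm (hM.contMDiff_orbitMap.mdifferentiable (by simp))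
    (hj.contMDiff.mdifferentiable (by simp)) hAN
  have hJ : IsSimplyTransitive θ (orbitForm EG G EM o) J (lieMetric EA AN) :=
    h𝔞.isCartanSubspace.isSimplyTransitive hθ hP isInnerProduct_lieMetric h_pullback hj.range_lieMap
  have hA : IsUnitNormal (lieMetric EA AN) (lieMetric ES S) f A :=
    h𝔞.isCartanSubspace.isUnitNormal hθ hc h_pullback hj.range_lieMap hH hH_unit
      (fun x y ↦ (lieMetric_lieMap hS x y).symm) hι.injective_lieMap hι.range_lieMap
  have hAN_left := hM.isLeftInvariantMetric hAN
  have hS_left := hM.isLeftInvariantMetric (j := j.comp ι) (hAN.comp hS)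
  have hU := hnablaAN.isAlgebraicLeviCivita_leftCovariant hAN_left
  have hV := hnablaS.isAlgebraicLeviCivita_leftCovariant hS_left
  have hRicAN := hJ.algebraicRicci_eq hQ hθ hc_pos.ne' hc hU isParsevalFrame_lieBasis
  obtain ⟨D, hD, hRicS⟩ := hJ.exists_lieDerivation_ricci hQ hθ hc_pos.ne' hc hU hV hA (h𝔞.le hH)
    isParsevalFrame_lieBasis
  simp only [← hnablaAN.ricciOperator_eq hAN_left, ← hnablaS.ricciOperator_eq hS_left]
    at hRicAN hRicS
  have h_solvable := isSolvable_of_mem_sup hP h𝔞.abelian (f := J.comp f)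
    (hj.injective_lieMap.comp hι.injective_lieMap) fun x ↦ hj.range_lieMap.le ⟨_, rfl⟩
  exact ⟨⟨h_solvable, _, LinearMap.trace ℝ _ D.toLinearMap • D, hRicS⟩, -(2 * c)⁻¹,
    neg_neg_of_pos (by positivity), hRicAN, D,
    fun v ↦ (congrArg J (hD v)).trans (J.map_lie _ _), hRicS⟩
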